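/- For a $C^*$-algebra $A$ let $l^\infty(A)$ be the $C^*$-algebra of norm-bounded sequences in $A$, let $c_0(A)$ be its ideal of sequences converging to $0$ in norm, let $\pi_\infty: l^\infty(A)\to l^\infty(A)/c_0(A)$ be the quotient map, and for $a\in A$ put $\iota_A(a)=\pi_\infty(a,a,a,\dots)$. A $C^*$-subalgebra $B\subset l^\infty(A)/c_0(A)$ is called strictly embedded if every $b\in B$ can be written as $b=\pi_\infty(b_1,b_2,\dots)$ with $\|b\|=\liminf_{n}\|b_n\|$. For positive elements $a,b$ of a $C^*$-algebra $D$, write $a\lesssim_D b$ if there are $x_i\in D$ with $\lim_{i\to\infty}\|a-x_i^*bx_i\|=0$. A unital $C^*$-algebra has stable rank one if its invertible elements are norm dense. Let $\mathcal S$ be the class of unital $C^*$-algebras of stable rank one. A unital simple $C^*$-algebra $A$ is called asymptotically tracially in $\mathcal S$ if for any finite subset $\mathcal F\subset A$, any $\varepsilon>0$ and any nonzero positive $a\in A$ there exist $B\in\mathcal S$ and completely positive contractive linear maps $\alpha:A\to B$, $\beta_n:B\to A$ and $\gamma_n:A\to A$ ($n\in\mathbb N$) such that (i) $\|x-(\gamma_n(x)+\beta_n(\alpha(x)))\|<\varepsilon$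 for all $x\in\mathcal F$ and all $n$; (ii) $\|\alpha(xy)-\alpha(x)\alpha(y)\|<\varepsilon$ and $|\|\alpha(x)\|-\|x\||<\varepsilon$ for all $x,y\in\mathcal F$; (iii) $\lim_{n\to\infty}\|\beta_n(xy)-\beta_n(x)\beta_n(y)\|=0$ and $\lim_{n\to\infty}\|\beta_n(x)\|=\|x\|$ for all $x,y\in B$; (iv) $\gamma_n(1_A)\lesssim_A a$ for all $n$. **Theorem.** Let $A$ be a unital simple $C^*$-algebra. (a) Suppose that for any finite subset $\mathcal F\subset A$, any $\varepsilon>0$ and any nonzero positive $a\in A$ there exists a strictly embedded $C^*$-subalgebra $B\subset l^\infty(A)/c_0(A)$ that has a unit $1_B$ (not necessarily equal to $\iota_A(1_A)$) and belongs to $\mathcal S$, such that (1) $\|1_B\iota_A(x)-\iota_A(x)1_B\|<\varepsilon$ for all $x\in\mathcal F$; (2) for every $x\in\mathcal F$ there is $b\in B$ with $\|1_B\iota_A(x)1_B-b\|<\varepsilon$, and $\|1_B\iota_A(x)1_B\|\ge\|x\|-\varepsilon$; (3) $\iota_A(1_A)-1_B\lesssim_{l^\infty(A)/c_0(A)}\iota_A(a)$.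 Then $A$ has stable rank one. (b) Consequently, if $A$ is asymptotically tracially in $\mathcal S$, then $A$ has stable rank one. -/

import Mathlib

open Filter Topology
open scoped ENNReal CStarAlgebra

universe u v

noncomputable section

namespace TracialApprox

/-! ### The sequence algebras `l^∞(A)`, `c_0(A)` and `l^∞(A)/c_0(A)` -/

/-- `l^∞(A)`: all norm-bounded sequences in `A`, with the supremum norm and pointwise operations. -/
abbrev LInf (A : Type u) [NonUnitalCStarAlgebra A] : Type u := lp (fun _ : ℕ => A) ∞

/-- `c_0(A)`: the sequences in `l^∞(A)` that converge to zero in norm. -/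
def cZero (A : Type u) [NonUnitalCStarAlgebra A] : Submodule ℂ (LInf A) where
  carrier := {a | Tendsto (fun n => a n) atTop (𝓝 0)}
  zero_mem' := by
    simp
  add_mem' := by
    intro a b ha hb
    simpa using Tendsto.add ha hb
  smul_mem' := by
    intro c a ha
    simpa using Tendsto.const_smul ha c

section Quotient

variable {A : Type u} [NonUnitalCStarAlgebra A]

theorem mem_cZero {a : LInf A} : a ∈ cZero A ↔ Tendsto (fun n => a n) atTop (𝓝 0) := Iff.rfl

theorem mul_mem_cZero_left (b : LInf A) {a : LInf A} (ha : a ∈ cZero A) : b * a ∈ cZero A := by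
  rw [mem_cZero, tendsto_zero_iff_norm_tendsto_zero] at ha ⊢
  have h := ha.const_mul ‖b‖
  rw [mul_zero] at h
  refine squeeze_zero (fun n => norm_nonneg _) (fun n => ?_) h
  exact (norm_mul_le (b n) (a n)).trans
    (mul_le_mul_of_nonneg_right (lp.norm_apply_le_norm ENNReal.top_ne_zero b n) (norm_nonneg _))

theorem mul_mem_cZero_right (b : LInf A) {a : LInf A} (ha : a ∈ cZero A) : a * b ∈ cZero A := by
  rw [mem_cZero, tendsto_zero_iff_norm_tendsto_zero] at ha ⊢
  have h := ha.mul_const ‖b‖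
  rw [zero_mul] at h
  refine squeeze_zero (fun n => norm_nonneg _) (fun n => ?_) h
  exact (norm_mul_le (a n) (b n)).trans
    (mul_le_mul_of_nonneg_left (lp.norm_apply_le_norm ENNReal.top_ne_zero b n) (norm_nonneg _))

theorem star_mem_cZero {a : LInf A} (ha : a ∈ cZero A) : star a ∈ cZero A := by
  rw [mem_cZero, tendsto_zero_iff_norm_tendsto_zero] at ha ⊢
  simpa using ha

instance isClosed_cZero : IsClosed (cZero A : Set (LInf A)) := by
  refine isClosed_of_closure_subset fun a ha => ?_
  rw [SetLike.mem_coe, mem_cZero, Metric.tendsto_atTop]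
  intro ε hε
  obtain ⟨b, hb, hab⟩ := Metric.mem_closure_iff.1 ha (ε / 2) (half_pos hε)
  obtain ⟨N, hN⟩ := Metric.tendsto_atTop.1 (mem_cZero.1 hb) (ε / 2) (half_pos hε)
  refine ⟨N, fun n hn => ?_⟩
  have h1 : dist (a n) (b n) ≤ dist a b := by
    rw [dist_eq_norm, dist_eq_norm]
    exact lp.norm_apply_le_norm ENNReal.top_ne_zero (a - b) n
  linarith [dist_triangle (a n) (b n) 0, hN n hn]

end Quotient

/-- The quotient `l^∞(A)/c_0(A)`. -/
def SeqAlg (A : Type u) [NonUnitalCStarAlgebra A] : Type u := LInf A ⧸ cZero A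

section Quotient

variable {A : Type u} [NonUnitalCStarAlgebra A]

/-- The norm of `l^∞(A)/c_0(A)` is the quotient norm. -/
instance : NormedAddCommGroup (SeqAlg A) := inferInstanceAs (NormedAddCommGroup (LInf A ⧸ cZero A))

instance : NormedSpace ℂ (SeqAlg A) := inferInstanceAs (NormedSpace ℂ (LInf A ⧸ cZero A))

instance : CompleteSpace (SeqAlg A) := inferInstanceAs (CompleteSpace (LInf A ⧸ cZero A))

/-- The quotient map `π_∞ : l^∞(A) → l^∞(A)/c_0(A)`. -/
def piInf (A : Type u) [NonUnitalCStarAlgebra A] : LInf A →ₗ[ℂ] SeqAlg A := (cZero A).mkQ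

theorem piInf_surjective : Function.Surjective (piInf A) := (cZero A).mkQ_surjective

theorem piInf_eq {a b : LInf A} : piInf A a = piInf A b ↔ a - b ∈ cZero A :=
  Submodule.Quotient.eq (cZero A)

theorem norm_piInf_le (a : LInf A) : ‖piInf A a‖ ≤ ‖a‖ := Submodule.Quotient.norm_mk_le (cZero A) a

theorem exists_piInf_norm_lt (x : SeqAlg A) {ε : ℝ} (hε : 0 < ε) :
    ∃ a : LInf A, piInf A a = x ∧ ‖a‖ < ‖x‖ + ε := Submodule.Quotient.norm_mk_lt x hε

/-- Multiplication of `l^∞(A)/c_0(A)`: `π_∞(a) π_∞(b) = π_∞(a b)`. -/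
instance : Mul (SeqAlg A) :=
  ⟨Quotient.map₂ (fun a b : LInf A => a * b) (by
    intro a a' ha b b' hb
    replace ha := (Submodule.quotientRel_def (cZero A)).1 ha
    replace hb := (Submodule.quotientRel_def (cZero A)).1 hb
    refine (Submodule.quotientRel_def (cZero A)).2 ?_
    have h : a * b - a' * b' = a * (b - b') + (a - a') * b' := by
      rw [mul_sub, sub_mul]; abel
    rw [h]
    exact (cZero A).add_mem (mul_mem_cZero_left a hb) (mul_mem_cZero_right b' ha))⟩

/-- Involution of `l^∞(A)/c_0(A)`: `π_∞(a)^* = π_∞(a^*)`. -/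
instance : Star (SeqAlg A) :=
  ⟨Quotient.map (fun a : LInf A => star a) (by
    intro a a' ha
    replace ha := (Submodule.quotientRel_def (cZero A)).1 ha
    refine (Submodule.quotientRel_def (cZero A)).2 ?_
    rw [← star_sub]
    exact star_mem_cZero ha)⟩

theorem piInf_mul (a b : LInf A) : piInf A (a * b) = piInf A a * piInf A b := rfl

theorem piInf_star (a : LInf A) : piInf A (star a) = star (piInf A a) := rfl

instance : NonUnitalRing (SeqAlg A) :=
  { (inferInstance : AddCommGroup (SeqAlg A)), (inferInstance : Mul (SeqAlg A)) with
    left_distrib := by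
      intro x y z
      obtain ⟨a, rfl⟩ := piInf_surjective x
      obtain ⟨b, rfl⟩ := piInf_surjective y
      obtain ⟨c, rfl⟩ := piInf_surjective z
      rw [← map_add, ← piInf_mul, ← piInf_mul, ← piInf_mul, ← map_add, mul_add]
    right_distrib := by
      intro x y z
      obtain ⟨a, rfl⟩ := piInf_surjective x
      obtain ⟨b, rfl⟩ := piInf_surjective y
      obtain ⟨c, rfl⟩ := piInf_surjective z
      rw [← map_add, ← piInf_mul, ← piInf_mul, ← piInf_mul, ← map_add, add_mul]
    zero_mul := by
      intro x
      obtain ⟨a, rfl⟩ := piInf_surjective x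
      rw [← map_zero (piInf A), ← piInf_mul, zero_mul]
    mul_zero := by
      intro x
      obtain ⟨a, rfl⟩ := piInf_surjective x
      rw [← map_zero (piInf A), ← piInf_mul, mul_zero]
    mul_assoc := by
      intro x y z
      obtain ⟨a, rfl⟩ := piInf_surjective x
      obtain ⟨b, rfl⟩ := piInf_surjective y
      obtain ⟨c, rfl⟩ := piInf_surjective z
      rw [← piInf_mul, ← piInf_mul, ← piInf_mul, ← piInf_mul, mul_assoc] }

instance : NonUnitalNormedRing (SeqAlg A) :=
  { (inferInstance : NormedAddCommGroup (SeqAlg A)), (inferInstance : NonUnitalRing (SeqAlg A)) with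
    norm_mul_le := by
      intro x y
      have key : ∀ ε : ℝ, 0 < ε → ‖x * y‖ ≤ (‖x‖ + ε) * (‖y‖ + ε) := by
        intro ε hε
        obtain ⟨a, rfl, ha⟩ := exists_piInf_norm_lt x hε
        obtain ⟨b, rfl, hb⟩ := exists_piInf_norm_lt y hε
        rw [← piInf_mul]
        exact (norm_piInf_le _).trans ((norm_mul_le a b).trans
          (mul_le_mul ha.le hb.le (norm_nonneg _) ((norm_nonneg a).trans ha.le)))
      have hlim : Tendsto (fun ε : ℝ => (‖x‖ + ε) * (‖y‖ + ε)) (𝓝[>] 0) (𝓝 (‖x‖ * ‖y‖)) := by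
        have hc : Continuous fun ε : ℝ => (‖x‖ + ε) * (‖y‖ + ε) := by fun_prop
        have h0 := (hc.tendsto 0).mono_left (nhdsWithin_le_nhds (s := Set.Ioi 0))
        simpa using h0
      exact ge_of_tendsto hlim (eventually_nhdsWithin_of_forall fun ε hε => key ε hε) }

instance : StarRing (SeqAlg A) where
  star_involutive := by
    intro x
    obtain ⟨a, rfl⟩ := piInf_surjective x
    rw [← piInf_star, ← piInf_star, star_star]
  star_mul := by
    intro x y
    obtain ⟨a, rfl⟩ := piInf_surjective x
    obtain ⟨b, rfl⟩ := piInf_surjective y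
    rw [← piInf_mul, ← piInf_star, ← piInf_star, ← piInf_star, ← piInf_mul, star_mul]
  star_add := by
    intro x y
    obtain ⟨a, rfl⟩ := piInf_surjective x
    obtain ⟨b, rfl⟩ := piInf_surjective y
    rw [← map_add, ← piInf_star, ← piInf_star, ← piInf_star, ← map_add, star_add]

instance : IsScalarTower ℂ (SeqAlg A) (SeqAlg A) where
  smul_assoc := by
    intro c x y
    obtain ⟨a, rfl⟩ := piInf_surjective x
    obtain ⟨b, rfl⟩ := piInf_surjective y
    rw [smul_eq_mul, smul_eq_mul, ← map_smul, ← piInf_mul, ← piInf_mul, ← map_smul, smul_mul_assoc]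

instance : SMulCommClass ℂ (SeqAlg A) (SeqAlg A) where
  smul_comm := by
    intro c x y
    obtain ⟨a, rfl⟩ := piInf_surjective x
    obtain ⟨b, rfl⟩ := piInf_surjective y
    rw [smul_eq_mul, smul_eq_mul, ← map_smul, ← piInf_mul, ← piInf_mul, ← map_smul, mul_smul_comm]

instance : StarModule ℂ (SeqAlg A) where
  star_smul := by
    intro c x
    obtain ⟨a, rfl⟩ := piInf_surjective x
    rw [← map_smul, ← piInf_star, ← piInf_star, ← map_smul, star_smul]

/-- If `‖a n‖ ≤ r` eventually, then `‖π_∞(a)‖ ≤ r`. -/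
theorem norm_piInf_le_of_eventually (a : LInf A) {r : ℝ} (hr : 0 ≤ r)
    (h : ∀ᶠ n in atTop, ‖a n‖ ≤ r) : ‖piInf A a‖ ≤ r := by
  classical
  obtain ⟨N, hN⟩ := eventually_atTop.1 h
  let f : ℕ → A := fun n => if N ≤ n then a n else 0
  have hf : ∀ n, ‖f n‖ ≤ r := by
    intro n
    by_cases hn : N ≤ n
    · simpa [f, hn] using hN n hn
    · simpa [f, hn] using hr
  let b : LInf A := ⟨f, memℓp_infty ⟨r, by rintro _ ⟨n, rfl⟩; exact hf n⟩⟩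
  have hab : piInf A a = piInf A b := by
    rw [piInf_eq, mem_cZero]
    refine tendsto_const_nhds.congr' ?_
    filter_upwards [eventually_ge_atTop N] with n hn
    change (0 : A) = a n - f n
    simp [f, hn]
  rw [hab]
  exact (norm_piInf_le b).trans (lp.norm_le_of_forall_le hr hf)

instance : CStarRing (SeqAlg A) where
  norm_mul_self_le := by
    intro x
    obtain ⟨a, rfl⟩ := piInf_surjective x
    refine le_of_forall_pos_le_add fun ε hε => ?_
    obtain ⟨b, hb, hbn⟩ := exists_piInf_norm_lt (star (piInf A a) * piInf A a) (half_pos hε)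
    rw [← piInf_star, ← piInf_mul] at hb hbn ⊢
    set R : ℝ := ‖piInf A (star a * a)‖ + ε with hR
    have hR0 : 0 ≤ R := add_nonneg (norm_nonneg _) hε.le
    have hc := (mem_cZero.1 (piInf_eq.1 hb))
    have hev : ∀ᶠ n in atTop, ‖a n‖ ≤ √R := by
      filter_upwards [Metric.tendsto_nhds.1 hc (ε / 2) (half_pos hε)] with n hn
      have h1 : ‖b n - star (a n) * a n‖ < ε / 2 := by
        rw [dist_zero_right] at hn
        exact hn
      have h2 : ‖star (a n) * a n‖ ≤ ‖b n‖ + ‖b n - star (a n) * a n‖ := by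
        rw [norm_sub_rev]
        have := norm_add_le (b n) (star (a n) * a n - b n)
        simpa using this
      have h3 : ‖b n‖ ≤ ‖b‖ := lp.norm_apply_le_norm ENNReal.top_ne_zero b n
      rw [CStarRing.norm_star_mul_self] at h2
      refine Real.le_sqrt_of_sq_le ?_
      rw [sq]
      linarith
    have hle := norm_piInf_le_of_eventually a (Real.sqrt_nonneg R) hev
    calc ‖piInf A a‖ * ‖piInf A a‖ ≤ √R * √R :=
          mul_le_mul hle hle (norm_nonneg _) (Real.sqrt_nonneg _)
      _ = R := Real.mul_self_sqrt hR0

/-- `l^∞(A)/c_0(A)` is a C⋆-algebra. -/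
instance : NonUnitalCStarAlgebra (SeqAlg A) where

/-- The constant sequence `(a, a, a, …)` in `l^∞(A)`. -/
def constSeq (a : A) : LInf A :=
  ⟨fun _ => a, memℓp_infty ⟨‖a‖, by rintro _ ⟨_, rfl⟩; exact le_rfl⟩⟩

/-- The map `ι_A : A → l^∞(A)/c_0(A)` that sends `a` to the class of `(a, a, a, …)`. -/
def iotaInf (a : A) : SeqAlg A := piInf A (constSeq a)

/-- A subset `B` of `l^∞(A)/c_0(A)` (in practice a C⋆-subalgebra) is strictly embedded if
each `b ∈ B` has a representing bounded sequence `(b_n)` with `‖b‖ = liminf ‖b_n‖`. -/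
def StrictlyEmbedded (B : Set (SeqAlg A)) : Prop :=
  ∀ b ∈ B, ∃ s : LInf A, piInf A s = b ∧ ‖b‖ = liminf (fun n => ‖s n‖) atTop

end Quotient

/-! ### Simplicity, stable rank one, Cuntz subequivalence -/

/-- A C⋆-algebra is simple if it is nonzero and has no closed two-sided ideals other than
`0` and itself. -/
def IsSimpleCStar (A : Type u) [NonUnitalCStarAlgebra A] : Prop :=
  Nontrivial A ∧ ∀ I : TwoSidedIdeal A, IsClosed (I : Set A) → I = ⊥ ∨ I = ⊤

/-- The class of unital algebras of stable rank one: there is a unit `e`, and the elements that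
are invertible with respect to `e` are norm dense. The unit is not part of the data, so that
the notion applies to a subalgebra whose unit is not the unit of the ambient algebra. -/
def UnitalStableRankOne (B : Type u) [NonUnitalRing B] [TopologicalSpace B] : Prop :=
  ∃ e : B, (∀ x : B, e * x = x ∧ x * e = x) ∧ Dense {x : B | ∃ y : B, x * y = e ∧ y * x = e}

/-- For an algebra with a given unit this says that the invertible elements are dense. -/
theorem unitalStableRankOne_iff (A : Type u) [CStarAlgebra A] :
    UnitalStableRankOne A ↔ Dense {x : A | IsUnit x} := by
  have hset : {x : A | ∃ y : A, x * y = 1 ∧ y * x = 1} = {x : A | IsUnit x} := by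
    ext x
    constructor
    · rintro ⟨y, h1, h2⟩
      exact ⟨⟨x, y, h1, h2⟩, rfl⟩
    · rintro ⟨w, rfl⟩
      exact ⟨↑w⁻¹, w.mul_inv, w.inv_mul⟩
  constructor
  · rintro ⟨e, he, hd⟩
    have h1 : e = 1 := by simpa using (he 1).1
    rw [h1, hset] at hd
    exact hd
  · intro hd
    exact ⟨1, fun x => ⟨one_mul x, mul_one x⟩, by rw [hset]; exact hd⟩

/-- Cuntz subequivalence `a ≲ b` in `A`: there are `x_i ∈ A` with `‖a - x_i^* b x_i‖ → 0`. -/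
def CuntzLE {A : Type u} [NonUnitalCStarAlgebra A] (a b : A) : Prop :=
  ∃ x : ℕ → A, Tendsto (fun i => ‖a - star (x i) * b * x i‖) atTop (𝓝 0)

/-! ### Tracial approximation -/

/-- `A` is asymptotically tracially in the class `P` of C⋆-algebras. -/
def AsymptoticallyTraciallyIn (P : ∀ (B : Type v) [NonUnitalCStarAlgebra B], Prop)
    (A : Type u) [CStarAlgebra A] [PartialOrder A] [StarOrderedRing A] : Prop :=
  ∀ (F : Finset A) (ε : ℝ), 0 < ε → ∀ a : A, 0 ≤ a → a ≠ 0 →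
    ∃ (B : Type v) (_ : NonUnitalCStarAlgebra B) (_ : PartialOrder B) (_ : StarOrderedRing B)
      (α : A →CP B) (β : ℕ → (B →CP A)) (γ : ℕ → (A →CP A)),
      P B ∧
      -- all the maps are contractive
      (∀ x, ‖α x‖ ≤ ‖x‖) ∧ (∀ n x, ‖β n x‖ ≤ ‖x‖) ∧ (∀ n x, ‖γ n x‖ ≤ ‖x‖) ∧
      (∀ x ∈ F, ∀ n, ‖x - (γ n x + β n (α x))‖ < ε) ∧
      -- `α` is an `(F, ε)`-approximate embedding
      (∀ x ∈ F, ∀ y ∈ F, ‖α (x * y) - α x * α y‖ < ε) ∧ (∀ x ∈ F, |‖α x‖ - ‖x‖| < ε) ∧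
      (∀ x y : B, Tendsto (fun n => ‖β n (x * y) - β n x * β n y‖) atTop (𝓝 0)) ∧
      (∀ x : B, Tendsto (fun n => ‖β n x‖) atTop (𝓝 ‖x‖)) ∧
      (∀ n, CuntzLE (γ n 1) a)

/-- `A` is tracially approximated by strictly embedded unital C⋆-subalgebras `B` of
`l^∞(A)/c_0(A)` of stable rank one. Here `e` is the unit `1_B` of `B`. -/
def ApproximatedByStableRankOne (A : Type u) [CStarAlgebra A] [PartialOrder A]
    [StarOrderedRing A] : Prop :=
  ∀ (F : Finset A) (ε : ℝ), 0 < ε → ∀ a : A, 0 ≤ a → a ≠ 0 →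
    ∃ (B : NonUnitalStarSubalgebra ℂ (SeqAlg A)) (e : SeqAlg A),
      IsClosed (B : Set (SeqAlg A)) ∧
      StrictlyEmbedded (B : Set (SeqAlg A)) ∧
      UnitalStableRankOne B ∧
      e ∈ B ∧ (∀ b ∈ B, e * b = b ∧ b * e = b) ∧
      (∀ x ∈ F, ‖e * iotaInf x - iotaInf x * e‖ < ε) ∧
      (∀ x ∈ F, ∃ b ∈ B, ‖e * iotaInf x * e - b‖ < ε) ∧
      (∀ x ∈ F, ‖x‖ - ε ≤ ‖e * iotaInf x * e‖) ∧
      CuntzLE (iotaInf (1 : A) - e) (iotaInf a)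

end TracialApprox

end

namespace TracialApprox

/-! ### Limits of invertible elements -/

section Invertibles

variable {A : Type u} [CStarAlgebra A]

/-! Both hypotheses yield one local property, `ApproxCornerApproximable`, and after an exact
projection is produced, `CornerApproximable`: a projection `e` nearly commutes with given elements,
their compressions are close to invertibles of `e A e`, the norm of a chosen `z` nearly survives
compression, and `1 - e = y⋆ y` where `y` lies under a prescribed element. For (a), `e` comes from
lifting `1_B` to a sequence; for (b), from `β n (α 1)`. Thus (b) is obtained in parallel with (a),
not through it.

From this property and simplicity the density of invertibles follows by reductions. One-sided
inverses are two-sided (`mul_eq_one_symm_of_cornerApproximable`), so for a noninvertible `x` neither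
`x⋆ x` nor `x x⋆` is invertible. Cutting `x` near `0` in both spectra, and joining the two cutoffs
by simplicity, gives a small perturbation with a nonzero two-sided annihilator `z`. In a corner
where `z` survives, `z` is close to `b = W P` with `W` unitary; then `x W` is almost annihilated on
both sides by `b⋆ b`, which reduces the problem to a positive annihilator
(`mem_closure_isUnit_of_mul_eq_zero'`).

For a positive annihilator, choose `e` so that `g = 1 - e` is equivalent to a projection lying under
that annihilator. Then `x` is close to `e x e + g x g`, and up to a unitary the first block is
self-adjoint, hence harmless. The second block has room to be rotated: the partial isometry `y`
moves it into the space that `x` kills, where a small self-adjoint off-diagonal term and a unipotent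
factor recreate it (`compression_add_mem_closure_isUnit`). -/

theorem isUnit_of_norm_sub_one_lt {x : A} (h : ‖x - 1‖ < 1) : IsUnit x := by
  rw [norm_sub_rev] at h
  simpa using isUnit_one_sub_of_norm_lt_one h

theorem isUnit_of_norm_mul_sub_one_lt {x y : A} (h₁ : ‖x * y - 1‖ < 1) (h₂ : ‖y * x - 1‖ < 1) :
    IsUnit x := by
  obtain ⟨u, hu⟩ := isUnit_of_norm_sub_one_lt h₁
  obtain ⟨w, hw⟩ := isUnit_of_norm_sub_one_lt h₂
  refine isUnit_iff_exists_and_exists.2 ⟨⟨y * ↑u⁻¹, ?_⟩, ⟨↑w⁻¹ * y, ?_⟩⟩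
  · rw [← mul_assoc, ← hu, u.mul_inv]
  · rw [mul_assoc, ← hw, w.inv_mul]

theorem mul_mem_closure_isUnit {x w : A} (hx : x ∈ closure {x : A | IsUnit x})
    (hw : IsUnit w) : w * x ∈ closure {x : A | IsUnit x} :=
  map_mem_closure (continuous_const_mul w) hx fun _ ha => hw.mul ha

theorem mul_mem_closure_isUnit_right {x w : A} (hx : x ∈ closure {x : A | IsUnit x})
    (hw : IsUnit w) : x * w ∈ closure {x : A | IsUnit x} :=
  map_mem_closure (f := fun y => y * w) (by fun_prop) hx fun _ ha => IsUnit.mul ha hw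

theorem mem_closure_isUnit_of_forall_norm_sub_lt {x : A}
    (h : ∀ ε : ℝ, 0 < ε → ∃ y ∈ closure {x : A | IsUnit x}, ‖x - y‖ < ε) :
    x ∈ closure {x : A | IsUnit x} := by
  rw [← closure_closure, Metric.mem_closure_iff]
  simpa [dist_eq_norm] using h

theorem IsSelfAdjoint.isUnit_add_smul_one {a : A} (ha : IsSelfAdjoint a) {r : ℝ} (hr : r ≠ 0) :
    IsUnit (a + ((r : ℂ) * Complex.I) • (1 : A)) := by
  have h : -((r : ℂ) * Complex.I) ∉ spectrum ℂ a := by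
    intro hmem
    have := ha.im_eq_zero_of_mem_spectrum hmem
    simp at this
    exact hr this
  rw [spectrum.notMem_iff] at h
  have h2 := h.neg
  rwa [neg_sub, map_neg, sub_neg_eq_add, Algebra.algebraMap_eq_smul_one] at h2

/-- The spectrum is real, so an arbitrarily small imaginary shift avoids it. -/
theorem IsSelfAdjoint.mem_closure_isUnit {a : A} (ha : IsSelfAdjoint a) :
    a ∈ closure {x : A | IsUnit x} := by
  have hc : Continuous fun r : ℝ => a + ((r : ℂ) * Complex.I) • (1 : A) := by fun_prop
  have h0 := (hc.tendsto 0).mono_left (nhdsWithin_le_nhds (s := {0}ᶜ))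
  simp only [Complex.ofReal_zero, zero_mul, zero_smul, add_zero] at h0
  refine mem_closure_of_tendsto h0 ?_
  filter_upwards [self_mem_nhdsWithin] with r hr
  exact IsSelfAdjoint.isUnit_add_smul_one ha hr

/-- If `P` is self-adjoint and `y` maps into the complement of `m`, then the compression of
`P + t y⋆ y` by `m` (up to order) is a limit of invertible elements. -/
theorem compression_add_mem_closure_isUnit {P m y : A} (hP : IsSelfAdjoint P)
    (hm : IsSelfAdjoint m) (hym : star y * m = 0) (t : A) :
    m * P * m + m * t * (star y * y) * m ∈ closure {x : A | IsUnit x} := by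
  have key : ∀ δ : ℝ, δ ≠ 0 →
      m * P * m + m * t * (star y * y) * m + (δ : ℂ) • (y * m + m * star y) ∈
        closure {x : A | IsUnit x} := by
    intro δ hδ
    have hN : IsSelfAdjoint (m * P * m + (δ : ℂ) • (y * m + m * star y)) := by
      rw [isSelfAdjoint_iff]
      simp only [star_add, star_mul, star_smul, star_star, hm.star_eq, hP.star_eq, RCLike.star_def,
        Complex.conj_ofReal, mul_assoc]
      rw [add_comm (m * star y)]
    -- Because `star y * m = 0`, `c` squares to zero and kills everything that begins with `m`. On
    -- the small term it leaves only `δ • (y * m)`, and the scaling by `δ⁻¹` turns this into the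
    -- full-size block `m t y⋆ y m`, independent of `δ`.
    set c : A := ((δ : ℂ)⁻¹) • (m * t * star y) with hc
    have hc2 : c * c = 0 := by
      have : m * t * star y * (m * t * star y) = 0 := by
        calc m * t * star y * (m * t * star y) = m * t * (star y * m) * t * star y := by
              noncomm_ring
          _ = 0 := by rw [hym]; simp
      rw [hc, smul_mul_smul_comm, this, smul_zero]
    have hU : IsUnit (1 + c) := by
      refine ⟨⟨1 + c, 1 - c, ?_, ?_⟩, rfl⟩
      · calc (1 + c) * (1 - c) = 1 - c * c := by noncomm_ring
          _ = 1 := by rw [hc2, sub_zero]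
      · calc (1 - c) * (1 + c) = 1 - c * c := by noncomm_ring
          _ = 1 := by rw [hc2, sub_zero]
    have hmem := mul_mem_closure_isUnit (IsSelfAdjoint.mem_closure_isUnit hN) hU
    have h1 : c * (m * P * m) = 0 := by
      have : m * t * star y * (m * P * m) = m * t * (star y * m) * P * m := by noncomm_ring
      rw [hc, smul_mul_assoc, this, hym]
      simp
    have h2 : c * ((δ : ℂ) • (y * m + m * star y)) = m * t * (star y * y) * m := by
      have : m * t * star y * (y * m + m * star y) =
          m * t * (star y * y) * m + m * t * (star y * m) * star y := by noncomm_ring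
      rw [hc, smul_mul_smul_comm, inv_mul_cancel₀ (by exact_mod_cast hδ), one_smul, this, hym]
      simp
    have h3 : (1 + c) * (m * P * m + (δ : ℂ) • (y * m + m * star y)) =
        m * P * m + m * t * (star y * y) * m + (δ : ℂ) • (y * m + m * star y) := by
      rw [add_mul, one_mul, mul_add, h1, h2]
      abel
    rwa [h3] at hmem
  have hc : Continuous fun δ : ℝ =>
      m * P * m + m * t * (star y * y) * m + (δ : ℂ) • (y * m + m * star y) := by fun_prop
  have h0 := (hc.tendsto 0).mono_left (nhdsWithin_le_nhds (s := {0}ᶜ))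
  simp only [Complex.ofReal_zero, zero_smul, add_zero] at h0
  refine isClosed_closure.mem_of_tendsto h0 ?_
  filter_upwards [self_mem_nhdsWithin] with r hr
  exact key r hr

end Invertibles

/-! ### Spectral cutoffs -/

section Cutoff

variable {A : Type u} [CStarAlgebra A]

/-- Non-invertibility puts `0` in the spectrum of `x⋆ x`; `d` and `d'` are bump functions of `x⋆ x`
at `0`, with `d` equal to `1` on the support of `d'`. Replacing `x` by `x (1 - d)` costs at most `ε`
and makes `d'` a right annihilator. -/
theorem exists_cutoff_of_not_isUnit {x : A} (hx : ¬IsUnit (star x * x)) {ε : ℝ} (hε : 0 < ε) :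
    ∃ d d' : A, IsSelfAdjoint d ∧ IsSelfAdjoint d' ∧ ‖d‖ ≤ 1 ∧ d * d' = d' ∧ d' ≠ 0 ∧
      ‖x * d‖ ≤ ε := by
  have hT : IsSelfAdjoint (star x * x) := .star_mul_self x
  have h0 : (0 : ℝ) ∈ spectrum ℝ (star x * x) := spectrum.zero_mem ℝ hx
  set T := star x * x with hTdef
  -- `f` vanishes beyond `2 * η = ε ^ 2`, which bounds `‖x * d‖ ^ 2`.
  set η : ℝ := ε ^ 2 / 2 with hη
  have hηpos : 0 < η := by positivity
  let f : ℝ → ℝ := fun t => max 0 (min 1 (2 - t / η))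
  let g : ℝ → ℝ := fun t => max 0 (1 - t / η)
  have hf : Continuous f := by fun_prop
  have hg : Continuous g := by fun_prop
  have hf1 : ∀ t, |f t| ≤ 1 := fun t => by
    rw [abs_of_nonneg (le_max_left _ _)]
    exact max_le zero_le_one (min_le_left _ _)
  refine ⟨cfc f T, cfc g T, cfc_predicate f T, cfc_predicate g T, ?_, ?_, ?_, ?_⟩
  · exact norm_cfc_le zero_le_one fun t _ => hf1 t
  · rw [← cfc_mul f g T hf.continuousOn hg.continuousOn]
    congr 1
    funext t
    change f t * g t = g t
    rcases le_or_gt (t / η) 1 with h | h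
    · have : f t = 1 := by
        simp only [f]
        rw [min_eq_left (by linarith), max_eq_right zero_le_one]
      rw [this, one_mul]
    · have : g t = 0 := max_eq_left (by linarith)
      rw [this, mul_zero]
  · intro h
    have h2 := norm_apply_le_norm_cfc g T h0 hg.continuousOn
    rw [h] at h2
    simp [g] at h2
    linarith
  · have h1 : star (x * cfc f T) * (x * cfc f T) = cfc (fun t => f t * t * f t) T := by
      have hs : star (cfc f T) = cfc f T := (cfc_predicate f T : IsSelfAdjoint _).star_eq
      rw [cfc_mul (fun t => f t * t) f T (by fun_prop) hf.continuousOn,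
        cfc_mul f (fun t => t) T hf.continuousOn (by fun_prop), cfc_id' ℝ T, star_mul, hs, hTdef]
      noncomm_ring
    have h2 : ‖cfc (fun t => f t * t * f t) T‖ ≤ ε ^ 2 := by
      refine norm_cfc_le (by positivity) fun t ht => ?_
      have ht0 : 0 ≤ t := spectrum_star_mul_self_nonneg t ht
      rw [Real.norm_eq_abs, abs_mul, abs_mul, abs_of_nonneg ht0]
      rcases le_or_gt (t / η) 2 with h | h
      · rw [div_le_iff₀ hηpos] at h
        have := hf1 t
        have h3 := abs_nonneg (f t)
        calc |f t| * t * |f t| ≤ 1 * t * 1 := by gcongr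
          _ ≤ ε ^ 2 := by rw [hη] at h; linarith
      · have : f t = 0 := by
          simp only [f]
          rw [max_eq_left]
          exact (min_le_right _ _).trans (by linarith)
        rw [this]
        simp
        positivity
    rw [← h1, CStarRing.norm_star_mul_self, ← sq] at h2
    exact (sq_le_sq₀ (norm_nonneg _) hε.le).1 h2

/-- On the spectrum `d` is `min 1 (2 t / ‖k‖)`, and `d'` lives where `t > ‖k‖ / 2`, so `d` is a unit
for it. The factorizations through `j` let a product that is small or zero with `k` stay so with
`d`, with a controlled loss. -/
theorem exists_cutoff_of_nonneg [PartialOrder A] [StarOrderedRing A] {k : A} (hk : 0 ≤ k)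
    (hk0 : k ≠ 0) :
    ∃ j d d' : A, IsSelfAdjoint d ∧ 0 ≤ d' ∧ d = k * j ∧ d = j * k ∧ ‖j‖ ≤ 2 / ‖k‖ ∧
      ‖d‖ ≤ 1 ∧ d * d' = d' ∧ d' ≠ 0 := by
  have : Nontrivial A := ⟨k, 0, hk0⟩
  have hks : IsSelfAdjoint k := .of_nonneg hk
  have hr : 0 < ‖k‖ := norm_pos_iff.2 hk0
  have hmem := CStarAlgebra.norm_mem_spectrum_of_nonneg (a := k)
  set r := ‖k‖ with hrdef
  let j : ℝ → ℝ := fun t => (2 / r) / max 1 (2 * t / r)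
  let g : ℝ → ℝ := fun t => max 0 (2 * t / r - 1)
  have hpos : ∀ t : ℝ, 0 < max 1 (2 * t / r) := fun t => lt_max_of_lt_left one_pos
  have hj : Continuous j := by
    refine Continuous.div (by fun_prop) (by fun_prop) fun t => (hpos t).ne'
  have hg : Continuous g := by fun_prop
  have hid : Continuous (fun t : ℝ => t) := continuous_id
  have h1 : cfc (fun t => t * j t) k = k * cfc j k := by
    rw [cfc_mul (fun t => t) j k hid.continuousOn hj.continuousOn, cfc_id' ℝ k]
  have h2 : cfc (fun t => t * j t) k = cfc j k * k := by
    rw [h1]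
    have h := cfc_commute_cfc (fun t : ℝ => t) j k
    rw [cfc_id' ℝ k] at h
    exact h.eq
  refine ⟨cfc j k, cfc (fun t => t * j t) k, cfc g k, cfc_predicate _ k,
    cfc_nonneg fun t _ => le_max_left _ _, h1, h2, ?_, ?_, ?_, ?_⟩
  · refine norm_cfc_le (by positivity) fun t _ => ?_
    rw [Real.norm_of_nonneg (by positivity)]
    exact div_le_self (by positivity) (le_max_left _ _)
  · refine norm_cfc_le zero_le_one fun t ht => ?_
    have ht0 : 0 ≤ t := spectrum_nonneg_of_nonneg hk ht
    rw [Real.norm_of_nonneg (by positivity)]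
    simp only [j]
    rw [mul_div_assoc', div_le_one (hpos t)]
    exact le_max_of_le_right (by field_simp; rfl)
  · rw [← cfc_mul (fun t => t * j t) g k (by fun_prop) hg.continuousOn]
    congr 1
    funext t
    change t * j t * g t = g t
    rcases le_or_gt (2 * t / r) 1 with h | h
    · have : g t = 0 := max_eq_left (by linarith)
      rw [this, mul_zero]
    · have ht : 0 < t := by
        rw [lt_div_iff₀ hr] at h
        linarith
      have : t * j t = 1 := by
        simp only [j]
        rw [max_eq_right h.le]
        field_simp
      rw [this, one_mul]
  · intro h
    have h2 := norm_apply_le_norm_cfc g k hmem hg.continuousOn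
    have h3 : g r = 1 := by
      simp only [g]
      rw [mul_div_assoc, div_self hr.ne']
      norm_num
    rw [h, h3] at h2
    simp at h2
    linarith

end Cutoff

/-! ### Corners, and elements with a positive annihilator -/

section CornerApproximation

variable {A : Type u} [CStarAlgebra A]

/-- `A` is approximated by corners `e A e` in which given elements are close to invertible
elements, where `1 - e` is equivalent to a projection on which a given element `d` acts as a
unit. -/
def CornerApproximable (A : Type u) [CStarAlgebra A] : Prop :=
  ∀ (F : Finset A) (ε : ℝ), 0 < ε → ∀ z d k : A, IsSelfAdjoint k → k ≠ 0 → d * k = k →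
    ∃ e : A, IsSelfAdjoint e ∧ e * e = e ∧ (∀ x ∈ F, ‖e * x - x * e‖ ≤ ε) ∧
      (∀ x ∈ F, ∃ b : A, e * b = b ∧ b * e = b ∧ IsUnit (b + (1 - e)) ∧ ‖b - e * x * e‖ ≤ ε) ∧
      ‖z‖ - ε ≤ ‖e * z * e‖ ∧ ∃ y : A, d * y = y ∧ star y * y = 1 - e

/-- Polar decomposition of an invertible element of a corner. -/
theorem exists_unitary_mul_eq_of_isUnit_add {e b : A} (he : IsSelfAdjoint e)
    (hee : e * e = e) (heb : e * b = b) (hbe : b * e = b) (hb : IsUnit (b + (1 - e))) :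
    ∃ W P : A, star W * W = 1 ∧ W * star W = 1 ∧ IsSelfAdjoint P ∧ W * (1 - e) = 1 - e ∧
      W * P = b := by
  let _ := CStarAlgebra.spectralOrder A
  have _ := CStarAlgebra.spectralOrderedRing A
  set v := b + (1 - e) with hv
  have hse := he.star_eq
  have hev : e * v = v * e := by
    rw [hv, mul_add, add_mul, heb, hbe, mul_sub, sub_mul, hee]
    simp
  have hve : v * e = b := by rw [hv, add_mul, hbe, sub_mul, hee]; simp
  have hev' : e * star v = star v * e := by
    have := congrArg star hev
    rw [star_mul, star_mul, hse] at this
    exact this.symm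
  set S := CFC.abs v with hS
  have hSsa : IsSelfAdjoint S := .of_nonneg (CFC.abs_nonneg v)
  have hSS : S * S = star v * v := CFC.abs_mul_abs v
  -- As `v` and `star v` commute with `e`, so does `|v|`; the polar decomposition of `v` therefore
  -- splits along `e` and `1 - e`.
  have hSe : Commute S e := (Commute.cfcAbs_left (Commute.symm hev) (by rw [hse]; exact Commute.symm hev))
  have hSu : IsUnit S := by
    have h : IsUnit (S * S) := by rw [hSS]; exact hb.star.mul hb
    exact ((Commute.refl S).isUnit_mul_iff.1 h).1
  obtain ⟨s, hs⟩ := hSu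
  have hri : S * ↑s⁻¹ = 1 := by rw [← hs]; exact s.mul_inv
  have hli : ↑s⁻¹ * S = 1 := by rw [← hs]; exact s.inv_mul
  set R : A := ↑s⁻¹ with hR
  have hRs : star R = R := by
    have h1 : star R * S = 1 := by
      have := congrArg star hri
      rwa [star_mul, hSsa.star_eq, star_one] at this
    calc star R = star R * (S * R) := by rw [hri, mul_one]
      _ = R := by rw [← mul_assoc, h1, one_mul]
  have hRe : R * e = e * R := by
    calc R * e = R * (e * S) * R := by rw [mul_assoc, mul_assoc, hri, mul_one]
      _ = R * S * e * R := by rw [← hSe.eq]; noncomm_ring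
      _ = e * R := by rw [hli, one_mul]
  have hRv : R * (star v * v) * R = 1 := by
    rw [← hSS, ← mul_assoc, hli, one_mul, hri]
  have hvR : v * (R * R) * star v = 1 := by
    obtain ⟨w, hw⟩ := hb
    have h1 : star v * v * (R * R) = 1 := by
      rw [← hSS]
      calc S * S * (R * R) = S * (S * R) * R := by noncomm_ring
        _ = 1 := by rw [hri, mul_one, hri]
    have h2 : star v * (v * (R * R) * star v - 1) = 0 := by
      calc star v * (v * (R * R) * star v - 1) = (star v * v * (R * R)) * star v - star v := by
            noncomm_ring
        _ = 0 := by rw [h1, one_mul, sub_self]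
    have h3 : IsUnit (star v) := by rw [← hw]; exact w.isUnit.star
    have h4 := (h3.mul_right_eq_zero).1 h2
    exact sub_eq_zero.1 h4
  set g := 1 - e with hg
  have hgg : g * g = g := by rw [hg]; simp [sub_mul, mul_sub, hee]
  have heg : e * g = 0 := by rw [hg, mul_sub, hee, mul_one, sub_self]
  have hge : g * e = 0 := by rw [hg, sub_mul, hee, one_mul, sub_self]
  have hsg : star g = g := by rw [hg, star_sub, star_one, hse]
  have hWs : star (v * R * e + g) = e * R * star v + g := by
    rw [star_add, star_mul, star_mul, hRs, hse, hsg, mul_assoc]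
  refine ⟨v * R * e + g, e * S * e, ?_, ?_, ?_, ?_, ?_⟩
  · rw [hWs]
    calc (e * R * star v + g) * (v * R * e + g)
        = e * (R * (star v * v) * R) * e + e * R * (star v * g) + g * v * R * e + g * g := by
          noncomm_ring
      _ = 1 := by
        have h1 : e * R * (star v * g) = 0 := by
          have : star v * g = g * star v := by rw [hg, mul_sub, sub_mul, hev']; simp
          calc e * R * (star v * g) = (e * R) * g * star v := by rw [this, mul_assoc]; noncomm_ring
            _ = R * (e * g) * star v := by rw [← hRe, mul_assoc R]
            _ = 0 := by rw [heg]; simp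
        have h2 : g * v * R * e = 0 := by
          have : g * v = v * g := by rw [hg, mul_sub, sub_mul, hev]; simp
          calc g * v * R * e = v * (g * (R * e)) := by rw [this]; noncomm_ring
            _ = 0 := by rw [hRe, ← mul_assoc g, hge]; simp
        rw [hRv, h1, h2, hgg, mul_one, hee, hg]
        abel
  · rw [hWs]
    calc (v * R * e + g) * (e * R * star v + g)
        = v * (R * (e * e) * R) * star v + v * R * (e * g) + (g * e) * R * star v + g * g := by
          noncomm_ring
      _ = v * (e * (R * R)) * star v + g := by
          rw [hee, heg, hge, hRe, hgg]
          noncomm_ring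
      _ = e * (v * (R * R) * star v) + g := by
          rw [← mul_assoc v, ← hev]
          noncomm_ring
      _ = 1 := by
        rw [hvR, hg]
        noncomm_ring
  · rw [isSelfAdjoint_iff, star_mul, star_mul, hse, hSsa.star_eq, mul_assoc]
  · rw [add_mul, hgg, mul_assoc, heg, mul_zero, zero_add]
  · calc (v * R * e + g) * (e * S * e) = v * R * (e * e) * S * e + (g * e) * S * e := by
          noncomm_ring
      _ = v * (R * e) * S * e := by rw [hee, hge]; noncomm_ring
      _ = v * e * (R * S) * e := by rw [hRe]; noncomm_ring
      _ = b := by rw [hli, mul_one, mul_assoc, hee, hve]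

theorem norm_mul_le_of_norm_le {a b : A} {r s : ℝ} (ha : ‖a‖ ≤ r) (hb : ‖b‖ ≤ s) :
    ‖a * b‖ ≤ r * s :=
  (norm_mul_le a b).trans (mul_le_mul ha hb (norm_nonneg _) ((norm_nonneg _).trans ha))

theorem norm_le_one_of_projection {e : A} (he : IsSelfAdjoint e) (hee : e * e = e) : ‖e‖ ≤ 1 := by
  have h : ‖e‖ * ‖e‖ = ‖e‖ := by
    rw [← CStarRing.norm_star_mul_self, he.star_eq, hee]
  nlinarith [norm_nonneg e]

theorem norm_le_one_of_star_mul_self_eq_one {w : A} (h : star w * w = 1) : ‖w‖ ≤ 1 := by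
  have h1 : ‖w‖ * ‖w‖ = ‖(1 : A)‖ := by rw [← CStarRing.norm_star_mul_self, h]
  have h2 : ‖(1 : A)‖ ≤ 1 := norm_le_one_of_projection (.one A) (one_mul 1)
  nlinarith [norm_nonneg w]

/-- The complement `g = 1 - e` is made small enough to embed, through `y`, under a cutoff `k` with
`x k = k x = 0`. Modulo small errors, `x = W (P + g x g)`, and compressing by `m = 1 - k` changes
little, which is the form treated by `compression_add_mem_closure_isUnit` with `t = g * x`. -/
theorem mem_closure_isUnit_of_mul_eq_zero [PartialOrder A] [StarOrderedRing A]
    (hA : CornerApproximable A) {x d : A} (hd : 0 ≤ d) (hd0 : d ≠ 0) (hxd : x * d = 0)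
    (hdx : d * x = 0) : x ∈ closure {x : A | IsUnit x} := by
  classical
  obtain ⟨j, k, k', hk, hk', hkj, hjk, -, hk1, hkk', hk0⟩ := exists_cutoff_of_nonneg hd hd0
  have hxk : x * k = 0 := by rw [hkj, ← mul_assoc, hxd, zero_mul]
  have hkx : k * x = 0 := by rw [hjk, mul_assoc, hdx, mul_zero]
  refine mem_closure_isUnit_of_forall_norm_sub_lt fun ε hε => ?_
  set K : ℝ := 1 + ‖x‖ with hK
  have hK0 : 0 < K := by positivity
  have hxK : ‖x‖ ≤ K := by rw [hK]; linarith
  set η : ℝ := ε / (20 * K) with hη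
  have hη0 : 0 < η := by positivity
  -- The norm condition is not needed here, hence the value `0` for `z`.
  obtain ⟨e, he, hee, hcomm, hunit, -, y, hky, hyy⟩ :=
    hA {x, k} η hη0 0 k k' (.of_nonneg hk') hk0 hkk'
  obtain ⟨b, heb, hbe, hbu, hbx⟩ := hunit x (by simp)
  have hex := hcomm x (by simp)
  have hek := hcomm k (by simp)
  obtain ⟨W, P, hW, hW', hP, hWg, hWP⟩ := exists_unitary_mul_eq_of_isUnit_add he hee heb hbe hbu
  have he1 := norm_le_one_of_projection he hee
  have hW1 := norm_le_one_of_star_mul_self_eq_one hW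
  have hW1' : ‖star W‖ ≤ 1 := by rwa [norm_star]
  have hWu : IsUnit W := ⟨⟨W, star W, hW', hW⟩, rfl⟩
  set g := 1 - e with hg
  have hgsa : IsSelfAdjoint g := (IsSelfAdjoint.one A).sub he
  have hgg : g * g = g := by rw [hg]; simp [sub_mul, mul_sub, hee]
  have hg1 := norm_le_one_of_projection hgsa hgg
  set m := 1 - k with hm
  have hmsa : IsSelfAdjoint m := (IsSelfAdjoint.one A).sub hk
  have hym : star y * m = 0 := by
    have : m * y = 0 := by rw [hm, sub_mul, hky, one_mul, sub_self]
    have := congrArg star this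
    rwa [star_mul, hmsa.star_eq, star_zero] at this
  have hmem := mul_mem_closure_isUnit
    (compression_add_mem_closure_isUnit hP hmsa hym (g * x)) hWu
  rw [hyy] at hmem
  refine ⟨_, hmem, ?_⟩
  -- `P = W⋆ b` is near `W⋆ e x e`, and `e x e k` is near `e x k e = 0`.
  have hbk : ‖P * k‖ ≤ 2 * K * η := by
    have h1 : P = star W * b := by rw [← hWP, ← mul_assoc, hW, one_mul]
    have h2 : P * k = star W * ((b - e * x * e) * k + e * x * (e * k - k * e)) := by
      have h3 : e * x * (e * k - k * e) = e * x * e * k - e * (x * k) * e := by noncomm_ring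
      rw [h3, hxk, h1]
      noncomm_ring
    rw [h2]
    have h4 : ‖(b - e * x * e) * k + e * x * (e * k - k * e)‖ ≤ η * 1 + 1 * K * η :=
      norm_add_le_of_le (norm_mul_le_of_norm_le hbx hk1)
        (norm_mul_le_of_norm_le (norm_mul_le_of_norm_le he1 hxK) hek)
    refine (norm_mul_le_of_norm_le hW1' h4).trans ?_
    nlinarith [norm_nonneg x]
  have hkb : ‖k * P‖ ≤ 2 * K * η := by
    have : star (P * k) = k * P := by rw [star_mul, hk.star_eq, hP.star_eq]
    rw [← this, norm_star]
    exact hbk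
  have hgk : ‖g * k - k * g‖ ≤ η := by
    have : g * k - k * g = -(e * k - k * e) := by rw [hg]; noncomm_ring
    rw [this, norm_neg]
    exact hek
  have hxgk : ‖g * x * g * k‖ ≤ K * η := by
    have : g * x * g * k = g * x * (g * k - k * g) + g * (x * k) * g := by noncomm_ring
    rw [this, hxk, mul_zero, zero_mul, add_zero]
    simpa using norm_mul_le_of_norm_le (norm_mul_le_of_norm_le hg1 hxK) hgk
  have hkgx : ‖k * (g * x * g)‖ ≤ K * η := by
    have : k * (g * x * g) = -((g * k - k * g) * (x * g)) + g * (k * x) * g := by noncomm_ring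
    rw [this, hkx, mul_zero, zero_mul, add_zero, norm_neg, mul_comm K]
    simpa using norm_mul_le_of_norm_le hgk (norm_mul_le_of_norm_le hxK hg1)
  have hcomp : ∀ (t : A) (r : ℝ), ‖t * k‖ ≤ r → ‖k * t‖ ≤ r → ‖t - m * t * m‖ ≤ 3 * r := by
    intro t r h1 h2
    have : t - m * t * m = k * t + t * k - k * t * k := by rw [hm]; noncomm_ring
    rw [this]
    have := norm_sub_le_of_le (norm_add_le_of_le h2 h1) (norm_mul_le_of_norm_le h2 hk1)
    linarith
  -- Near-commutation with `e` removes the off-diagonal parts of `x`. Since `W` fixes `g`, it can be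
  -- factored out of `b + g x g`.
  have hfin : x - W * (m * P * m + m * (g * x) * g * m) =
      e * (e * x - x * e) - (e * x - x * e) * e - (b - e * x * e) +
      W * ((P - m * P * m) + (g * x * g - m * (g * x * g) * m)) := by
    have h1 : W * ((P - m * P * m) + (g * x * g - m * (g * x * g) * m)) =
        b + g * x * g - W * (m * P * m + m * (g * x) * g * m) := by
      have h2 : W * (g * x * g) = g * x * g := by rw [← mul_assoc, ← mul_assoc, hWg]
      calc _ = W * P + W * (g * x * g) - W * (m * P * m + m * (g * x) * g * m) := by noncomm_ring
        _ = _ := by rw [hWP, h2]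
    have h3 : e * (e * x - x * e) - (e * x - x * e) * e =
        (e * e) * x - e * x * e - e * x * e + x * (e * e) := by noncomm_ring
    rw [h1, h3, hee, hg]
    noncomm_ring
  rw [hfin]
  have h1 := norm_sub_le_of_le (norm_sub_le_of_le (norm_mul_le_of_norm_le he1 hex)
    (norm_mul_le_of_norm_le hex he1)) hbx
  have h2 := norm_mul_le_of_norm_le hW1
    (norm_add_le_of_le (hcomp P _ hbk hkb) (hcomp (g * x * g) _ hxgk hkgx))
  refine (norm_add_le_of_le h1 h2).trans_lt ?_
  have h3 : η * K * 20 = ε := by rw [hη]; field_simp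
  have h4 : η ≤ η * K := le_mul_of_one_le_right hη0.le (by rw [hK]; linarith [norm_nonneg x])
  nlinarith

end CornerApproximation

/-! ### Arbitrary annihilators, finiteness, and density of invertibles -/

section StableRankOne

variable {A : Type u} [CStarAlgebra A]

/-- A unitary factor does not affect membership in the closure, so `x` may be replaced by `x W`,
where `W` is the unitary in the polar decomposition of a corner element `b` near `z`. This turns the
left and right supports of `b` into one: `b⋆ b` almost annihilates `x W` on both sides. -/
theorem mem_closure_isUnit_of_mul_eq_zero' [PartialOrder A] [StarOrderedRing A]
    (hA : CornerApproximable A) {x z : A} (hz0 : z ≠ 0) (hxz : x * z = 0)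
    (hzx : z * x = 0) : x ∈ closure {x : A | IsUnit x} := by
  classical
  wlog hz1 : ‖z‖ = 1 generalizing z
  · refine this (z := ((‖z‖ : ℂ)⁻¹) • z) ?_ ?_ ?_ ?_
    · simp [hz0]
    · rw [mul_smul_comm, hxz, smul_zero]
    · rw [smul_mul_assoc, hzx, smul_zero]
    · rw [norm_smul, norm_inv, Complex.norm_real, norm_norm,
        inv_mul_cancel₀ (norm_ne_zero_iff.2 hz0)]
  have : Nontrivial A := ⟨z, 0, hz0⟩
  refine mem_closure_isUnit_of_forall_norm_sub_lt fun ε hε => ?_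
  set K : ℝ := 1 + ‖x‖ with hK
  have hK0 : 0 < K := by positivity
  have hxK : ‖x‖ + 1 ≤ K := by rw [hK]; linarith
  -- The bound `1 / 4` keeps `‖b‖ ≥ 1 / 2`, so that the cutoff factor `j` of `b⋆ b` has norm at most
  -- `8`.
  set η : ℝ := min (1 / 4) (ε / (100 * K)) with hη
  have hη0 : 0 < η := by positivity
  have hη1 : η ≤ 1 / 4 := min_le_left _ _
  have hη2 : η * K * 100 ≤ ε := by
    have : η ≤ ε / (100 * K) := min_le_right _ _
    rw [le_div_iff₀ (by positivity)] at this
    linarith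
  -- The size of `1 - e` is irrelevant here, so the cutoff pair is `1, 1`.
  obtain ⟨e, he, hee, hcomm, hunit, hnorm, -⟩ :=
    hA {x, z} η hη0 z 1 1 (.one A) one_ne_zero (one_mul 1)
  obtain ⟨b, heb, hbe, hbu, hbz⟩ := hunit z (by simp)
  have hex := hcomm x (by simp)
  have he1 := norm_le_one_of_projection he hee
  obtain ⟨W, P, hW, hW', hP, -, hWP⟩ := exists_unitary_mul_eq_of_isUnit_add he hee heb hbe hbu
  have hW1 := norm_le_one_of_star_mul_self_eq_one hW
  have hW1' : ‖star W‖ ≤ 1 := by rwa [norm_star]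
  have heze : ‖e * z * e‖ ≤ 1 := by
    simpa using norm_mul_le_of_norm_le (norm_mul_le_of_norm_le he1 hz1.le) he1
  have hb2 : ‖b‖ ≤ 2 := by
    have : b = (b - e * z * e) + e * z * e := by abel
    rw [this]
    linarith [norm_add_le_of_le hbz heze]
  have hb2' : ‖star b‖ ≤ 2 := by rwa [norm_star]
  have hbhalf : 1 / 2 ≤ ‖b‖ := by
    have h1 := norm_sub_norm_le (e * z * e) b
    rw [norm_sub_rev] at h1
    linarith
  have hxb : ‖x * b‖ ≤ K * η := by
    have : x * b = x * (b - e * z * e) + (-(e * x - x * e) * (z * e) + e * (x * z) * e) := by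
      noncomm_ring
    rw [this, hxz, mul_zero, zero_mul, add_zero]
    have h1 : ‖z * e‖ ≤ 1 := by simpa using norm_mul_le_of_norm_le hz1.le he1
    have h2 := norm_add_le_of_le (norm_mul_le_of_norm_le (le_refl ‖x‖) hbz)
      (norm_mul_le_of_norm_le (a := -(e * x - x * e)) ((norm_neg _).trans_le hex) h1)
    refine h2.trans ?_
    rw [hK]
    linarith
  have hbx : ‖b * x‖ ≤ K * η := by
    have : b * x = (b - e * z * e) * x + ((e * z) * (e * x - x * e) + e * (z * x) * e) := by
      noncomm_ring
    rw [this, hzx, mul_zero, zero_mul, add_zero]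
    have h1 : ‖e * z‖ ≤ 1 := by simpa using norm_mul_le_of_norm_le he1 hz1.le
    have h2 := norm_add_le_of_le (norm_mul_le_of_norm_le hbz (le_refl ‖x‖))
      (norm_mul_le_of_norm_le h1 hex)
    refine h2.trans ?_
    rw [hK]
    linarith
  have hPP : P * P = star b * b := by
    rw [← hWP, star_mul, hP.star_eq, mul_assoc, ← mul_assoc (star W), hW, one_mul]
  -- Conjugation by `W` takes `b⋆ b` to `b b⋆`; hence `x W b⋆ b = x b b⋆ W`, where `x b` is small.
  have hWPP : W * (P * P) = b * star b * W := by
    rw [← hWP, star_mul, hP.star_eq]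
    calc W * (P * P) = W * P * P * 1 := by noncomm_ring
      _ = _ := by rw [← hW]; noncomm_ring
  have hk0 : 0 ≤ star b * b := star_mul_self_nonneg b
  have hkn : ‖star b * b‖ = ‖b‖ * ‖b‖ := CStarRing.norm_star_mul_self
  have hkpos : 1 / 4 ≤ ‖star b * b‖ := by rw [hkn]; nlinarith
  obtain ⟨j, d, d', hd, hd', hdj, hjd, hj, hd1, hdd', hd0⟩ := exists_cutoff_of_nonneg hk0
    (norm_pos_iff.1 (by linarith))
  have hj8 : ‖j‖ ≤ 8 := by
    refine hj.trans ?_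
    rw [div_le_iff₀ (by linarith)]
    linarith
  have hd'd : d' * d = d' := by
    have := congrArg star hdd'
    rwa [star_mul, (IsSelfAdjoint.of_nonneg hd').star_eq, hd.star_eq] at this
  have hmem := mem_closure_isUnit_of_mul_eq_zero hA hd' hd0
    (x := (1 - d) * (x * W) * (1 - d))
    (by rw [mul_assoc, sub_mul 1 d d', hdd', one_mul, sub_self, mul_zero])
    (by rw [← mul_assoc, ← mul_assoc, mul_sub d' 1 d, hd'd, mul_one, sub_self, zero_mul, zero_mul])
  refine ⟨_, mul_mem_closure_isUnit_right hmem ⟨⟨star W, W, hW, hW'⟩, rfl⟩, ?_⟩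
  have h1 : ‖(x * W) * d‖ ≤ 16 * (K * η) := by
    have : x * W * d = (x * b) * star b * W * j := by
      rw [hdj, ← hPP]
      calc x * W * (P * P * j) = x * (W * (P * P)) * j := by noncomm_ring
        _ = _ := by rw [hWPP]; noncomm_ring
    rw [this]
    refine (norm_mul_le_of_norm_le (norm_mul_le_of_norm_le (norm_mul_le_of_norm_le hxb hb2') hW1)
      hj8).trans (le_of_eq (by ring))
  have h2 : ‖d * (x * W)‖ ≤ 16 * (K * η) := by
    have : d * (x * W) = j * star b * (b * x) * W := by
      rw [hjd]
      noncomm_ring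
    rw [this]
    refine (norm_mul_le_of_norm_le (norm_mul_le_of_norm_le (norm_mul_le_of_norm_le hj8 hb2') hbx)
      hW1).trans (le_of_eq (by ring))
  have h3 : x - (1 - d) * (x * W) * (1 - d) * star W =
      (d * (x * W) + x * W * d - d * (x * W) * d) * star W := by
    calc x - (1 - d) * (x * W) * (1 - d) * star W =
        x * (W * star W) - (1 - d) * (x * W) * (1 - d) * star W := by rw [hW', mul_one]
      _ = _ := by noncomm_ring
  rw [h3]
  have h4 := norm_mul_le_of_norm_le (norm_sub_le_of_le (norm_add_le_of_le h2 h1)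
    (norm_mul_le_of_norm_le h2 hd1)) hW1'
  refine h4.trans_lt ?_
  nlinarith

/-- If `p = 1 - x y` were nonzero, it would be an idempotent of norm at least `1`, nearly preserved
by some compression. In that corner `e y e` is almost a left inverse of the invertible `b ≈ e x e`,
hence almost a right inverse, and this makes `e p e` small. -/
theorem mul_eq_one_symm_of_cornerApproximable (hA : CornerApproximable A) {x y : A}
    (hyx : y * x = 1) : x * y = 1 := by
  classical
  by_contra hxy
  set p := 1 - x * y with hp
  have hp0 : p ≠ 0 := fun h => hxy (sub_eq_zero.1 h).symm
  have hpp : p * p = p := by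
    have : p * p = 1 - x * y - x * y + x * (y * x) * y := by rw [hp]; noncomm_ring
    rw [this, hyx, hp]
    noncomm_ring
  have hpn : 1 ≤ ‖p‖ := by
    have h1 := norm_mul_le p p
    rw [hpp] at h1
    have h2 : 0 < ‖p‖ := norm_pos_iff.2 hp0
    nlinarith
  have : Nontrivial A := ⟨p, 0, hp0⟩
  set X : ℝ := 1 + ‖x‖ with hX
  set Y : ℝ := 1 + ‖y‖ with hY
  have hX1 : 1 ≤ X := by rw [hX]; linarith [norm_nonneg x]
  have hY1 : 1 ≤ Y := by rw [hY]; linarith [norm_nonneg y]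
  have hxX : ‖x‖ ≤ X := by rw [hX]; linarith
  have hyY : ‖y‖ ≤ Y := by rw [hY]; linarith
  have hXY : 1 ≤ X * Y ^ 2 := one_le_mul_of_one_le_of_one_le hX1 (one_le_pow₀ hY1)
  have hYXY : Y ≤ X * Y ^ 2 := by nlinarith [mul_le_mul hX1 hY1 zero_le_one (by linarith)]
  set η : ℝ := 1 / (100 * (X * Y ^ 2)) with hη
  have hη0 : 0 < η := by positivity
  have hη1 : X * Y ^ 2 * η = 1 / 100 := by rw [hη]; field_simp
  have hηY : Y * η ≤ 1 / 100 := by rw [← hη1]; gcongr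
  have hηη : η ≤ 1 / 100 := by rw [← hη1]; exact le_mul_of_one_le_left hη0.le hXY
  obtain ⟨e, he, hee, hcomm, hunit, hnorm, -⟩ :=
    hA {x} η hη0 p 1 1 (.one A) one_ne_zero (one_mul 1)
  obtain ⟨b, heb, hbe, hbu, hbx⟩ := hunit x (by simp)
  have hex := hcomm x (by simp)
  have he1 := norm_le_one_of_projection he hee
  set g := 1 - e with hg
  have hgsa : IsSelfAdjoint g := (IsSelfAdjoint.one A).sub he
  have hgg : g * g = g := by rw [hg]; simp [sub_mul, mul_sub, hee]
  have heg : e * g = 0 := by rw [hg, mul_sub, hee, mul_one, sub_self]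
  have hge : g * e = 0 := by rw [hg, sub_mul, hee, one_mul, sub_self]
  have hbg : b * g = 0 := by rw [← hbe, mul_assoc, heg, mul_zero]
  have hg1 := norm_le_one_of_projection hgsa hgg
  obtain ⟨v, hv⟩ := hbu
  set t := e * y * e + g with ht
  set w : A := ↑v⁻¹ with hw
  have hvw : (b + g) * w = 1 := by rw [← hv]; exact v.mul_inv
  have hye : ‖y * e‖ ≤ Y := by simpa using norm_mul_le_of_norm_le hyY he1
  have hey : ‖e * y‖ ≤ Y := by simpa using norm_mul_le_of_norm_le he1 hyY
  have heye : ‖e * y * e‖ ≤ Y := by simpa using norm_mul_le_of_norm_le hey he1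
  have htn : ‖t‖ ≤ 2 * Y := by
    rw [ht]
    linarith [norm_add_le_of_le heye hg1]
  have hvn : ‖b + g‖ ≤ 3 * X := by
    have h1 : ‖e * x * e‖ ≤ X := by
      simpa using norm_mul_le_of_norm_le (norm_mul_le_of_norm_le he1 hxX) he1
    have h2 : b + g = (b - e * x * e) + e * x * e + g := by abel
    rw [h2]
    linarith [norm_add_le_of_le (norm_add_le_of_le hbx h1) hg1]
  have htv : ‖t * (b + g) - 1‖ ≤ 2 * Y * η := by
    have h1 : t * (b + g) - 1 =
        e * y * e * (b - e * x * e) + e * y * (e * x - x * e) * e := by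
      have h2 : t * (b + g) = e * y * (e * b) + e * y * (e * g) + (g * e) * b + g * g := by
        rw [ht]
        calc _ = e * y * (e * b) + e * y * (e * g) + g * b + g * g := by noncomm_ring
          _ = _ := by rw [mul_assoc g e b, heb]
      have h3 : e * y * e * (b - e * x * e) + e * y * (e * x - x * e) * e =
          e * y * (e * b) - e * y * (e * e) * x * e + e * y * e * x * e
            - e * (y * x) * (e * e) := by
        noncomm_ring
      rw [h2, h3, heg, hge, hgg, hee, hyx, hg, mul_one, hee]
      noncomm_ring
    rw [h1]
    have h2 := norm_add_le_of_le (norm_mul_le_of_norm_le heye hbx)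
      (norm_mul_le_of_norm_le (norm_mul_le_of_norm_le hey hex) he1)
    linarith
  have hwn : ‖w‖ ≤ 4 * Y := by
    have h1 : w = t - (t * (b + g) - 1) * w := by
      rw [sub_mul, mul_assoc, hvw]
      noncomm_ring
    have h2 : ‖(t * (b + g) - 1) * w‖ ≤ 2 * Y * η * ‖w‖ := norm_mul_le_of_norm_le htv le_rfl
    have h3 : ‖w‖ ≤ 2 * Y + 2 * Y * η * ‖w‖ := by
      conv_lhs => rw [h1]
      exact norm_sub_le_of_le htn h2
    nlinarith [norm_nonneg w]
  -- Conjugating the left defect `t (b + g) - 1` by the invertible `b + g` gives the right defect.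
  have hvt : ‖(b + g) * t - 1‖ ≤ 24 * (X * Y ^ 2 * η) := by
    have h1 : (b + g) * t - 1 = (b + g) * (t * (b + g) - 1) * w := by
      calc (b + g) * t - 1 = (b + g) * t * ((b + g) * w) - (b + g) * w := by rw [hvw, mul_one]
        _ = _ := by noncomm_ring
    rw [h1]
    refine (norm_mul_le_of_norm_le (norm_mul_le_of_norm_le hvn htv) hwn).trans (le_of_eq ?_)
    ring
  have hepe : e * p * e = -(e * ((b + g) * t - 1) * e) + (b - e * x * e) * (y * e)
      - (e * x - x * e) * g * (y * e) := by
    have h1 : e * ((b + g) * t - 1) * e = b * y * e - e := by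
      have : e * ((b + g) * t - 1) * e = (e * b) * e * y * (e * e) + (e * b) * (g * e)
          + (e * g) * t * e - e * e := by rw [ht]; noncomm_ring
      rw [this, heb, hee, hge, heg, hbe]
      noncomm_ring
    have h2 : (e * x - x * e) * g * (y * e) = e * x * g * (y * e) - x * (e * g) * (y * e) := by
      noncomm_ring
    have h3 : e * p * e = e * e - e * x * y * e := by rw [hp]; noncomm_ring
    rw [h1, h2, h3, heg, hee, hg]
    noncomm_ring
  have hfin : ‖e * p * e‖ ≤ 24 * (X * Y ^ 2 * η) + η * Y + η * Y := by
    rw [hepe]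
    have h1 : ‖-(e * ((b + g) * t - 1) * e)‖ ≤ 24 * (X * Y ^ 2 * η) := by
      rw [norm_neg]
      simpa using norm_mul_le_of_norm_le (norm_mul_le_of_norm_le he1 hvt) he1
    have h2 := norm_mul_le_of_norm_le (norm_mul_le_of_norm_le hex hg1) hye
    rw [mul_one] at h2
    exact norm_sub_le_of_le (norm_add_le_of_le h1 (norm_mul_le_of_norm_le hbx hye)) h2
  rw [hη1] at hfin
  linarith

/-- Otherwise the `t` with `c A t = 0` would form a closed two-sided ideal that contains `d` but not
`1`. -/
theorem exists_mul_mul_ne_zero (hA : IsSimpleCStar A) {c d : A} (hc : c ≠ 0) (hd : d ≠ 0) :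
    ∃ r : A, c * r * d ≠ 0 := by
  by_contra! h
  let I : TwoSidedIdeal A := .mk' {t : A | ∀ r, c * r * t = 0} (by simp)
    (by
      intro s t hs ht r
      rw [mul_add, hs r, ht r, add_zero])
    (by
      intro s hs r
      rw [mul_neg, hs r, neg_zero])
    (by
      intro s t ht r
      rw [← mul_assoc, mul_assoc c, ht])
    (by
      intro s t hs r
      rw [← mul_assoc, hs r, zero_mul])
  have hmem : ∀ t, t ∈ I ↔ ∀ r, c * r * t = 0 := fun t => TwoSidedIdeal.mem_mk' ..
  have hclosed : IsClosed (I : Set A) := by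
    have : (I : Set A) = ⋂ r : A, {t | c * r * t = 0} := by
      ext t
      simp [hmem]
    rw [this]
    exact isClosed_iInter fun r => isClosed_eq (by fun_prop) continuous_const
  rcases hA.2 I hclosed with hI | hI
  · have : d ∈ I := (hmem d).2 fun r => h r
    rw [hI, TwoSidedIdeal.mem_bot] at this
    exact hd this
  · have : (1 : A) ∈ I := by rw [hI]; trivial
    have h1 := (hmem 1).1 this 1
    rw [mul_one, mul_one] at h1
    exact hc h1

theorem dense_isUnit_of_cornerApproximable [PartialOrder A] [StarOrderedRing A]
    (hS : IsSimpleCStar A) (hA : CornerApproximable A) : Dense {x : A | IsUnit x} := by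
  intro x
  by_cases hx : IsUnit x
  · exact subset_closure hx
  have hl : ∀ {y : A}, IsUnit (star y * y) → IsUnit y := by
    rintro y ⟨u, hu⟩
    have h1 : ((↑u⁻¹ : A) * star y) * y = 1 := by rw [mul_assoc, ← hu, u.inv_mul]
    exact isUnit_iff_exists.2 ⟨_, mul_eq_one_symm_of_cornerApproximable hA h1, h1⟩
  have h1 : ¬IsUnit (star x * x) := fun h => hx (hl h)
  have h2 : ¬IsUnit (star (star x) * star x) := fun h => hx (isUnit_star.1 (hl h))
  refine mem_closure_isUnit_of_forall_norm_sub_lt fun ε hε => ?_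
  obtain ⟨d, d', hd, hd', hd1, hdd', hd0, hxd⟩ := exists_cutoff_of_not_isUnit h1 (ε := ε / 4)
    (by positivity)
  obtain ⟨c, c', hc, hc', hc1, hcc', hc0, hxc⟩ := exists_cutoff_of_not_isUnit h2 (ε := ε / 4)
    (by positivity)
  have hc'c : c' * c = c' := by
    have := congrArg star hcc'
    rwa [star_mul, hc.star_eq, hc'.star_eq] at this
  have hcx : ‖c * x‖ ≤ ε / 4 := by
    rwa [← norm_star, star_mul, hc.star_eq]
  -- `d' * r * c'` annihilates the doubly cut `x` on both sides: `1 - d` kills `d'` and `c'` kills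
  -- `1 - c`.
  obtain ⟨r, hr⟩ := exists_mul_mul_ne_zero hS hd0 hc0
  refine ⟨(1 - c) * x * (1 - d), mem_closure_isUnit_of_mul_eq_zero' hA hr ?_ ?_, ?_⟩
  · calc (1 - c) * x * (1 - d) * (d' * r * c') = (1 - c) * x * (d' - d * d') * r * c' := by
          noncomm_ring
      _ = 0 := by rw [hdd', sub_self]; simp
  · calc d' * r * c' * ((1 - c) * x * (1 - d)) = d' * r * (c' - c' * c) * x * (1 - d) := by
          noncomm_ring
      _ = 0 := by rw [hc'c, sub_self]; simp
  · have : x - (1 - c) * x * (1 - d) = c * x + x * d - c * x * d := by noncomm_ring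
    rw [this]
    have := norm_sub_le_of_le (norm_add_le_of_le hcx hxd) (norm_mul_le_of_norm_le hcx hd1)
    linarith

end StableRankOne

/-! ### From approximate to exact relations -/

section Perturbation

variable {A : Type u} [CStarAlgebra A]

/-- A version of `CornerApproximable` in which all relations hold approximately. -/
def ApproxCornerApproximable (A : Type u) [CStarAlgebra A] : Prop :=
  ∀ (F : Finset A) (ε : ℝ), 0 < ε → ∀ z d k : A, IsSelfAdjoint k → k ≠ 0 → d * k = k →
    ∃ s : A, IsSelfAdjoint s ∧ ‖s * s - s‖ ≤ ε ∧ (∀ x ∈ F, ‖s * x - x * s‖ ≤ ε) ∧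
      (∀ x ∈ F, ∃ v : A, IsUnit v ∧ ‖v - (s * x * s + (1 - s))‖ ≤ ε) ∧
      ‖z‖ - ε ≤ ‖s * z * s‖ ∧ ∃ y : A, d * y = y ∧ ‖star y * y - (1 - s)‖ ≤ ε

/-- The spectrum of `s` clusters at `0` and `1`; `f` is constant on each cluster and interpolates
only across the gap. -/
theorem exists_projection_norm_sub_le {s : A} (hs : IsSelfAdjoint s) {δ : ℝ} (hδ : δ ≤ 1 / 8)
    (h : ‖s * s - s‖ ≤ δ) : ∃ e : A, IsSelfAdjoint e ∧ e * e = e ∧ ‖e - s‖ ≤ 2 * δ := by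
  have hδ0 : 0 ≤ δ := (norm_nonneg _).trans h
  let f : ℝ → ℝ := fun t => max 0 (min 1 (2 * t - 1 / 2))
  have hf : Continuous f := by fun_prop
  have hspec : ∀ t ∈ spectrum ℝ s, |t * t - t| ≤ δ := by
    intro t ht
    have h1 := norm_apply_le_norm_cfc (fun t : ℝ => t * t - t) s ht (by fun_prop)
    rw [cfc_sub (fun t : ℝ => t * t) (fun t => t) s (by fun_prop) (by fun_prop),
      cfc_mul (fun t : ℝ => t) (fun t => t) s (by fun_prop) (by fun_prop), cfc_id' ℝ s] at h1
    exact h1.trans h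
  have hval : ∀ t ∈ spectrum ℝ s, (f t = 0 ∧ t ≤ 1 / 4) ∨ (f t = 1 ∧ 3 / 4 ≤ t) := by
    intro t ht
    have h1 := abs_le.1 (hspec t ht)
    rcases le_or_gt t (1 / 4) with h2 | h2
    · left
      refine ⟨max_eq_left ((min_le_right _ _).trans (by linarith)), h2⟩
    · right
      have h3 : 3 / 4 ≤ t := by nlinarith
      refine ⟨?_, h3⟩
      simp only [f]
      rw [min_eq_left (by linarith), max_eq_right zero_le_one]
  refine ⟨cfc f s, cfc_predicate f s, ?_, ?_⟩
  · rw [← cfc_mul f f s hf.continuousOn hf.continuousOn]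
    refine cfc_congr fun t ht => ?_
    rcases hval t ht with ⟨h1, -⟩ | ⟨h1, -⟩ <;> simp [h1]
  · have h1 : cfc f s - s = cfc (fun t => f t - t) s := by
      rw [cfc_sub f (fun t => t) s hf.continuousOn (by fun_prop), cfc_id' ℝ s]
    rw [h1]
    refine norm_cfc_le (by positivity) fun t ht => ?_
    have h2 := abs_le.1 (hspec t ht)
    rw [Real.norm_eq_abs, abs_le]
    rcases hval t ht with ⟨h1, h3⟩ | ⟨h1, h3⟩
    · rw [h1]
      constructor <;> rcases le_or_gt 0 t with h4 | h4 <;> nlinarith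
    · rw [h1]
      constructor <;> rcases le_or_gt t 1 with h4 | h4 <;> nlinarith

/-- An invertible element close to an element of a corner plus the complementary projection has an
invertible Schur complement. -/
theorem exists_isUnit_corner_of_norm_sub_le {e x v : A} (he : IsSelfAdjoint e)
    (hee : e * e = e) (hv : IsUnit v) {δ : ℝ} (hδ : δ ≤ 1 / 2)
    (h : ‖v - (e * x * e + (1 - e))‖ ≤ δ) :
    ∃ b : A, e * b = b ∧ b * e = b ∧ IsUnit (b + (1 - e)) ∧ ‖b - e * x * e‖ ≤ 2 * δ := by
  have hδ0 : 0 ≤ δ := (norm_nonneg _).trans h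
  have he1 := norm_le_one_of_projection he hee
  set g := 1 - e with hg
  have hgsa : IsSelfAdjoint g := (IsSelfAdjoint.one A).sub he
  have hgg : g * g = g := by rw [hg]; simp [sub_mul, mul_sub, hee]
  have heg : e * g = 0 := by rw [hg, mul_sub, hee, mul_one, sub_self]
  have hge : g * e = 0 := by rw [hg, sub_mul, hee, one_mul, sub_self]
  have hg1 := norm_le_one_of_projection hgsa hgg
  have heg1 : e + g = 1 := by rw [hg]; abel
  set r := v - (e * x * e + g) with hr
  have hvr : v = r + (e * x * e + g) := by rw [hr]; abel
  have hevg : e * v * g = e * r * g := by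
    rw [hvr]
    calc _ = e * r * g + e * e * x * (e * g) + (e * g) * g := by noncomm_ring
      _ = _ := by rw [heg]; simp
  have hgve : g * v * e = g * r * e := by
    rw [hvr]
    calc _ = g * r * e + (g * e) * x * e * e + g * (g * e) := by noncomm_ring
      _ = _ := by rw [hge]; simp
  have heve : e * v * e = e * r * e + e * x * e := by
    rw [hvr]
    calc _ = e * r * e + (e * e) * x * (e * e) + (e * g) * e := by noncomm_ring
      _ = _ := by rw [heg, hee]; simp
  set a := g * v * g + e with ha
  have ha1 : a - 1 = g * r * g := by
    rw [ha, hvr]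
    calc _ = g * r * g + (g * e) * x * e * g + (g * g) * g + e - 1 := by noncomm_ring
      _ = g * r * g + (e + g) - 1 := by rw [hge, hgg, hgg]; noncomm_ring
      _ = _ := by rw [heg1]; abel
  have ha1n : ‖a - 1‖ ≤ 1 / 2 := by
    rw [ha1]
    have := norm_mul_le_of_norm_le (norm_mul_le_of_norm_le hg1 h) hg1
    linarith
  obtain ⟨w, hw⟩ : IsUnit a := isUnit_of_norm_sub_one_lt (by linarith)
  have hae : a * e = e := by
    rw [ha]
    calc _ = g * v * (g * e) + e * e := by noncomm_ring
      _ = _ := by rw [hge, hee]; simp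
  have hea : e * a = e := by
    rw [ha]
    calc _ = (e * g) * v * g + e * e := by noncomm_ring
      _ = _ := by rw [heg, hee]; simp
  -- Adding `e` to `g v g` makes the lower block invertible in `A`; `k` inverts that block and fixes
  -- `e`.
  set k : A := ↑w⁻¹ with hk
  have hka : k * a = 1 := by rw [← hw]; exact w.inv_mul
  have hak : a * k = 1 := by rw [← hw]; exact w.mul_inv
  have hke : k * e = e := by rw [← hae, ← mul_assoc, hka, one_mul, hae]
  have hek : e * k = e := by rw [← hea, mul_assoc, hak, mul_one, hea]
  have hkg : k * g = g * k := by rw [hg, mul_sub, sub_mul, hke, hek, mul_one, one_mul]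
  have hone : ‖(1 : A)‖ ≤ 1 := norm_le_one_of_projection (.one A) (one_mul 1)
  have hkn : ‖k‖ ≤ 2 := by
    have h1 : k = 1 - (a - 1) * k := by rw [sub_mul, hak]; noncomm_ring
    have h2 : ‖(a - 1) * k‖ ≤ 1 / 2 * ‖k‖ := norm_mul_le_of_norm_le ha1n le_rfl
    have h3 : ‖k‖ ≤ 1 + 1 / 2 * ‖k‖ := by
      conv_lhs => rw [h1]
      exact norm_sub_le_of_le hone h2
    linarith
  have hkgvg : k * (g * v * g) = g := by
    have : g * v * g = a - e := by rw [ha]; abel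
    rw [this, mul_sub, hka, hke]
  have hgvgk : (g * v * g) * k = g := by
    have : g * v * g = a - e := by rw [ha]; abel
    rw [this, sub_mul, hak, hek]
  set p := e * v * g * k with hp
  set q := k * (g * v * e) with hq
  have hpg : p * g = p := by
    rw [hp, mul_assoc, hkg, ← mul_assoc, mul_assoc (e * v), hgg]
  have hgq : g * q = q := by
    calc g * q = (g * k) * (g * v * e) := by rw [hq, ← mul_assoc]
      _ = k * ((g * g) * v * e) := by rw [← hkg]; noncomm_ring
      _ = q := by rw [hgg]
  have hpp : p * p = 0 := by
    calc p * p = p * g * p := by rw [hpg]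
      _ = p * ((g * e) * v * g * k) := by rw [hp]; noncomm_ring
      _ = 0 := by rw [hge]; simp
  have hqq : q * q = 0 := by
    calc q * q = q * (g * q) := by rw [hgq]
      _ = k * g * v * (e * g) * q := by rw [hq]; noncomm_ring
      _ = 0 := by rw [heg]; simp
  have hunip : ∀ c : A, c * c = 0 → IsUnit (1 - c) := fun c hc => by
    refine isUnit_iff_exists.2 ⟨1 + c, ?_, ?_⟩
    · calc (1 - c) * (1 + c) = 1 - c * c := by noncomm_ring
        _ = 1 := by rw [hc, sub_zero]
    · calc (1 + c) * (1 - c) = 1 - c * c := by noncomm_ring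
        _ = 1 := by rw [hc, sub_zero]
  set b := e * v * e - p * (g * v * e) with hb
  have heb : e * b = b := by
    calc e * b = (e * e) * v * e - (e * e) * v * g * k * (g * v * e) := by
          rw [hb, hp]; noncomm_ring
      _ = b := by rw [hee]
  have hbe : b * e = b := by
    calc b * e = e * v * (e * e) - p * (g * v * (e * e)) := by rw [hb]; noncomm_ring
      _ = b := by rw [hee]
  have hbg : b * g = 0 := by rw [← hbe, mul_assoc, heg, mul_zero]
  -- Block elimination: the unipotents `1 - p` and `1 - q` clear both off-diagonal blocks of `v`,
  -- leaving the Schur complement `b` and `g v g`.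
  have hprod : (1 - p) * v * (1 - q) = (b + g) * a := by
    have h1 : p * v = p * (g * v * e) + e * v * g := by
      calc p * v = p * g * v * (e + g) := by rw [hpg, heg1, mul_one]
        _ = p * (g * v * e) + e * v * g * (k * (g * v * g)) := by rw [hp]; noncomm_ring
        _ = p * (g * v * e) + e * v * (g * g) := by rw [hkgvg]; noncomm_ring
        _ = _ := by rw [hgg]
    have h2 : (1 - p) * v = b + g * v := by
      calc (1 - p) * v = (e + g) * v * (e + g) - p * v := by rw [heg1]; noncomm_ring
        _ = e * v * e - p * (g * v * e) + g * v * (e + g) := by rw [h1]; noncomm_ring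
        _ = b + g * v := by rw [heg1, mul_one]
    have h3 : (b + g * v) * q = g * v * e := by
      calc (b + g * v) * q = (b + g * v) * (g * q) := by rw [hgq]
        _ = (b * g) * q + (g * v * g * k) * (g * v * e) := by rw [hq]; noncomm_ring
        _ = (g * g) * v * e := by rw [hbg, hgvgk]; noncomm_ring
        _ = _ := by rw [hgg]
    calc (1 - p) * v * (1 - q) = (b + g * v * (e + g)) - (b + g * v) * q := by
          rw [h2, heg1]; noncomm_ring
      _ = b + g * v * g := by rw [h3]; noncomm_ring
      _ = b * e + (b * g) * v * g + (g * g) * v * g + g * e := by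
          rw [hbe, hbg, hgg, hge]; noncomm_ring
      _ = _ := by rw [ha]; noncomm_ring
  refine ⟨b, heb, hbe, ?_, ?_⟩
  · have hu := ((hunip p hpp).mul hv).mul (hunip q hqq)
    rw [hprod, ← hw] at hu
    exact (Units.isUnit_mul_units _ w).1 hu
  · have h1 : b - e * x * e = e * r * e - e * r * g * k * (g * r * e) := by
      rw [hb, hp, heve, hevg, hgve]
      abel
    rw [h1]
    have h2 := norm_sub_le_of_le
      (norm_mul_le_of_norm_le (norm_mul_le_of_norm_le he1 h) he1)
      (norm_mul_le_of_norm_le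
        (norm_mul_le_of_norm_le (norm_mul_le_of_norm_le (norm_mul_le_of_norm_le he1 h) hg1) hkn)
        (norm_mul_le_of_norm_le (norm_mul_le_of_norm_le hg1 h) he1))
    nlinarith

/-- Normalize `y g` on the right by `a ^ (-1/2)`, where `a = g y⋆ y g + e` is near `1` and commutes
with `g`. Right multiplication preserves `d * y = y`. -/
theorem exists_star_mul_self_eq_of_norm_sub_le [PartialOrder A] [StarOrderedRing A]
    {e y d : A} (he : IsSelfAdjoint e) (hee : e * e = e) (hdy : d * y = y)
    (h : ‖star y * y - (1 - e)‖ ≤ 1 / 2) : ∃ y' : A, d * y' = y' ∧ star y' * y' = 1 - e := by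
  set g := 1 - e with hg
  have hgsa : IsSelfAdjoint g := (IsSelfAdjoint.one A).sub he
  have hgg : g * g = g := by rw [hg]; simp [sub_mul, mul_sub, hee]
  have heg : e * g = 0 := by rw [hg, mul_sub, hee, mul_one, sub_self]
  have hge : g * e = 0 := by rw [hg, sub_mul, hee, one_mul, sub_self]
  have hg1 := norm_le_one_of_projection hgsa hgg
  set a := g * (star y * y) * g + e with ha
  have ha0 : 0 ≤ a := by
    have h1 : a = star (y * g) * (y * g) + star e * e := by
      rw [star_mul, hgsa.star_eq, he.star_eq, hee, ha]
      noncomm_ring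
    rw [h1]
    exact add_nonneg (star_mul_self_nonneg _) (star_mul_self_nonneg _)
  have hau : IsUnit a := by
    have h1 : a - 1 = g * (star y * y - g) * g := by
      calc a - 1 = g * (star y * y) * g - g := by rw [ha, hg]; abel
        _ = g * (star y * y) * g - g * g * g := by rw [hgg, hgg]
        _ = _ := by noncomm_ring
    refine isUnit_of_norm_sub_one_lt ?_
    rw [h1]
    have := norm_mul_le_of_norm_le (norm_mul_le_of_norm_le hg1 h) hg1
    linarith
  have hpos : IsStrictlyPositive a := IsStrictlyPositive.iff_of_unital.2 ⟨ha0, hau⟩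
  have hag : a * g = g * (star y * y) * g := by
    calc a * g = g * (star y * y) * (g * g) + e * g := by rw [ha]; noncomm_ring
      _ = _ := by rw [hgg, heg, add_zero]
  have hga : g * a = g * (star y * y) * g := by
    calc g * a = (g * g) * (star y * y) * g + g * e := by rw [ha]; noncomm_ring
      _ = _ := by rw [hgg, hge, add_zero]
  set s : A := a ^ (-(1 / 2) : ℝ) with hs
  have hsas : s * a * s = 1 := CFC.conjugate_rpow_neg_one_half a
  have hssa : star s = s := (IsSelfAdjoint.of_nonneg CFC.rpow_nonneg).star_eq
  have hsg : Commute s g := by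
    rw [hs, CFC.rpow_def]
    exact Commute.cfc_nnreal (hag.trans hga.symm) _
  refine ⟨y * g * s, by rw [← mul_assoc, ← mul_assoc, hdy], ?_⟩
  calc star (y * g * s) * (y * g * s) = s * (g * (star y * y) * g) * s := by
        rw [star_mul, star_mul, hssa, hgsa.star_eq]
        noncomm_ring
    _ = s * a * (g * s) := by rw [← hag]; noncomm_ring
    _ = g := by rw [← hsg.eq, ← mul_assoc, hsas, one_mul]

theorem ApproxCornerApproximable.cornerApproximable [PartialOrder A] [StarOrderedRing A]
    (hA : ApproxCornerApproximable A) : CornerApproximable A := by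
  intro F ε hε z d k hk hk0 hdk
  set M : ℝ := 1 + (∑ x ∈ F, ‖x‖ + ‖z‖) with hM
  have hsum : 0 ≤ ∑ x ∈ F, ‖x‖ := Finset.sum_nonneg fun x _ => norm_nonneg x
  have hM1 : 1 ≤ M := by rw [hM]; linarith [norm_nonneg z]
  have hFM : ∀ x ∈ F, ‖x‖ ≤ M := fun x hx => by
    have := Finset.single_le_sum (f := fun x : A => ‖x‖) (fun x _ => norm_nonneg x) hx
    rw [hM]
    linarith [norm_nonneg z]
  have hzM : ‖z‖ ≤ M := by rw [hM]; linarith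
  have hM0 : 0 < M := by linarith
  set η : ℝ := min 1 ε / (100 * M) with hη
  have hη0 : 0 < η := by positivity
  have hηM : M * η * 100 = min 1 ε := by rw [hη]; field_simp
  have hM1' : M * η * 100 ≤ 1 := hηM.trans_le (min_le_left _ _)
  have hMε : M * η * 100 ≤ ε := hηM.trans_le (min_le_right _ _)
  have hηM' : η ≤ M * η := le_mul_of_one_le_left hη0.le hM1
  obtain ⟨s, hs, hss, hcomm, hunit, hnorm, y, hdy, hy⟩ := hA F η hη0 z d k hk hk0 hdk
  obtain ⟨e, he, hee, hes⟩ := exists_projection_norm_sub_le hs (by linarith) hss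
  have he1 := norm_le_one_of_projection he hee
  have hs2 : ‖s‖ ≤ 2 := by
    have h1 : s = e - (e - s) := by abel
    rw [h1]
    linarith [norm_sub_le_of_le he1 hes]
  have hcompr : ∀ x : A, ‖x‖ ≤ M → ‖e * x * e - s * x * s‖ ≤ 6 * (M * η) := by
    intro x hx
    have h1 : e * x * e - s * x * s = (e - s) * x * e + s * x * (e - s) := by noncomm_ring
    rw [h1]
    have h2 := norm_add_le_of_le
      (norm_mul_le_of_norm_le (norm_mul_le_of_norm_le hes hx) he1)
      (norm_mul_le_of_norm_le (norm_mul_le_of_norm_le hs2 hx) hes)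
    linarith
  refine ⟨e, he, hee, fun x hx => ?_, fun x hx => ?_, ?_, ?_⟩
  · have h1 : e * x - x * e = (s * x - x * s) + (e - s) * x - x * (e - s) := by noncomm_ring
    rw [h1]
    have h2 := norm_sub_le_of_le (norm_add_le_of_le (hcomm x hx)
      (norm_mul_le_of_norm_le hes (hFM x hx))) (norm_mul_le_of_norm_le (hFM x hx) hes)
    linarith
  · obtain ⟨v, hv, hvs⟩ := hunit x hx
    have h1 : ‖v - (e * x * e + (1 - e))‖ ≤ 9 * (M * η) := by
      have h2 : v - (e * x * e + (1 - e)) =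
          (v - (s * x * s + (1 - s))) - (e * x * e - s * x * s) + (e - s) := by abel
      rw [h2]
      linarith [norm_add_le_of_le (norm_sub_le_of_le hvs (hcompr x (hFM x hx))) hes]
    obtain ⟨b, heb, hbe, hbu, hb⟩ := exists_isUnit_corner_of_norm_sub_le he hee hv
      (by linarith) h1
    exact ⟨b, heb, hbe, hbu, by linarith⟩
  · have h1 := norm_sub_norm_le (s * z * s) (e * z * e)
    rw [norm_sub_rev] at h1
    linarith [hcompr z hzM]
  · refine exists_star_mul_self_eq_of_norm_sub_le he hee hdy ?_
    have h1 : star y * y - (1 - e) = (star y * y - (1 - s)) + (e - s) := by abel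
    rw [h1]
    linarith [norm_add_le_of_le hy hes]

end Perturbation

/-! ### Case (a): lifting from the sequence algebra -/

section SequenceAlgebra

variable {A : Type u} [CStarAlgebra A]

/-- If `r` and `r'` are almost inverse relative to an almost-unit `s`, then `r + (1 - s)` and `r' +
(1 - s)` are almost inverse in `A`: each product differs from `1` by four errors below `1 / 4`. -/
theorem isUnit_add_one_sub {r r' s : A} (h₁ : ‖r * r' - s‖ < 1 / 4) (h₂ : ‖r' * r - s‖ < 1 / 4)
    (h₃ : ‖r - r * s‖ < 1 / 4) (h₄ : ‖r - s * r‖ < 1 / 4) (h₅ : ‖r' - r' * s‖ < 1 / 4)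
    (h₆ : ‖r' - s * r'‖ < 1 / 4) (h₇ : ‖s * s - s‖ < 1 / 4) : IsUnit (r + (1 - s)) := by
  have key : ∀ {p q : A}, ‖p * q - s‖ < 1 / 4 → ‖p - p * s‖ < 1 / 4 → ‖q - s * q‖ < 1 / 4 →
      ‖(p + (1 - s)) * (q + (1 - s)) - 1‖ < 1 := by
    intro p q h h' h''
    have h1 : (p + (1 - s)) * (q + (1 - s)) - 1 =
        (p * q - s) + (p - p * s) + (q - s * q) + (s * s - s) := by noncomm_ring
    rw [h1]
    linarith [norm_add_le_of_le (norm_add_le_of_le (norm_add_le_of_le h.le h'.le) h''.le)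
      (le_refl ‖s * s - s‖)]
  exact isUnit_of_norm_mul_sub_one_lt (key h₁ h₃ h₆) (key h₂ h₅ h₄)

theorem eventually_norm_apply_lt {t : LInf A} {r : ℝ} (h : ‖piInf A t‖ < r) :
    ∀ᶠ n in atTop, ‖t n‖ < r := by
  obtain ⟨a, ha, har⟩ := exists_piInf_norm_lt (piInf A t) (ε := (r - ‖piInf A t‖) / 2)
    (by linarith)
  have hc := mem_cZero.1 (piInf_eq.1 ha)
  filter_upwards [Metric.tendsto_nhds.1 hc ((r - ‖piInf A t‖) / 2) (by linarith)] with n hn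
  have h1 : ‖a n - t n‖ < (r - ‖piInf A t‖) / 2 := by
    rw [dist_zero_right] at hn
    exact hn
  have h2 : ‖a n‖ ≤ ‖a‖ := lp.norm_apply_le_norm ENNReal.top_ne_zero a n
  have h3 := norm_sub_norm_le (t n) (a n)
  rw [norm_sub_rev] at h3
  linarith

theorem frequently_lt_norm_apply {t : LInf A} {r : ℝ} (h : r < ‖piInf A t‖) :
    ∃ᶠ n in atTop, r < ‖t n‖ := by
  intro hn
  have hn' : ∀ᶠ n in atTop, ‖t n‖ ≤ r := by
    filter_upwards [hn] with n h1
    exact not_lt.1 h1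
  obtain ⟨n, h0⟩ := hn'.exists
  exact h.not_ge (norm_piInf_le_of_eventually t ((norm_nonneg _).trans h0) hn')

theorem ApproximatedByStableRankOne.approxCornerApproximable [PartialOrder A] [StarOrderedRing A]
    (hA : ApproximatedByStableRankOne A) : ApproxCornerApproximable A := by
  classical
  intro F ε hε z d k hk hk0 hdk
  have hkk : 0 ≤ k * k := hk.mul_self_nonneg
  have hkk0 : k * k ≠ 0 := by
    intro h
    rw [← hk.star_eq] at h
    nth_rw 2 [hk.star_eq] at h
    exact hk0 (CStarRing.star_mul_self_eq_zero_iff k |>.1 h)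
  -- Comparing with `k * k` lets the witness be `y = k * w`, which inherits `d * y = y` from `d * k
  -- = k`.
  obtain ⟨B, e, -, -, hSR, heB, hunit, hcomm, hnear, hnorm, w, hw⟩ :=
    hA (insert z F) (ε / 2) (half_pos hε) (k * k) hkk hkk0
  have hee : e * e = e := (hunit e heB).1
  have hes : star e = e := by
    have h1 := (hunit (star e) (star_mem heB)).1
    have h2 := congrArg star h1
    rw [star_mul, star_star, h1] at h2
    exact h2
  obtain ⟨s, hs, hss⟩ : ∃ s : LInf A, piInf A s = e ∧ ∀ n, IsSelfAdjoint (s n) := by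
    obtain ⟨s₀, hs₀⟩ := piInf_surjective e
    refine ⟨(1 / 2 : ℂ) • (s₀ + star s₀), ?_, fun n => ?_⟩
    · rw [map_smul, map_add, piInf_star, hs₀, hes, ← two_smul ℂ, smul_smul]
      norm_num
    · change IsSelfAdjoint ((1 / 2 : ℂ) • (s₀ n + star (s₀ n)))
      rw [isSelfAdjoint_iff]
      simp [add_comm]
  have hev0 : ∀ {t : LInf A} {r : ℝ}, 0 < r → piInf A t = 0 → ∀ᶠ n in atTop, ‖t n‖ < r := by
    intro t r hr ht
    exact eventually_norm_apply_lt (by rwa [ht, norm_zero])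
  have hproj : ∀ r : ℝ, 0 < r → ∀ᶠ n in atTop, ‖s n * s n - s n‖ < r := fun r hr =>
    hev0 (t := s * s - s) hr (by rw [map_sub, piInf_mul, hs, hee, sub_self])
  have hF : ∀ x ∈ F, ∀ᶠ n in atTop, ‖s n * x - x * s n‖ ≤ ε ∧
      ∃ v : A, IsUnit v ∧ ‖v - (s n * x * s n + (1 - s n))‖ ≤ ε := by
    intro x hx
    have h1 : ∀ᶠ n in atTop, ‖s n * x - x * s n‖ < ε / 2 := by
      refine eventually_norm_apply_lt (t := s * constSeq x - constSeq x * s) ?_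
      rw [map_sub, piInf_mul, piInf_mul, hs]
      exact hcomm x (Finset.mem_insert_of_mem hx)
    obtain ⟨b, hbB, hb⟩ := hnear x (Finset.mem_insert_of_mem hx)
    obtain ⟨e', he', hd⟩ := hSR
    have hee' : (e' : SeqAlg A) = e := by
      have h2 := congrArg Subtype.val (he' ⟨e, heB⟩).1
      have h3 : (e' : SeqAlg A) * e = e := h2
      rw [← h3]
      exact ((hunit e' e'.2).2).symm
    obtain ⟨c, ⟨c', hcc', hc'c⟩, hbc⟩ := Metric.dense_iff.1 hd ⟨b, hbB⟩ (ε / 2) (half_pos hε)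
      |>.imp fun c hc => And.intro hc.2 hc.1
    have hcb : ‖(c : SeqAlg A) - b‖ < ε / 2 := by
      rw [Metric.mem_ball, Subtype.dist_eq, dist_eq_norm] at hbc
      exact hbc
    have h2 : (c : SeqAlg A) * c' = e := (congrArg Subtype.val hcc').trans hee'
    have h3 : (c' : SeqAlg A) * c = e := (congrArg Subtype.val hc'c).trans hee'
    obtain ⟨r, hr⟩ := piInf_surjective (c : SeqAlg A)
    obtain ⟨r', hr'⟩ := piInf_surjective (c' : SeqAlg A)
    have h4 : ‖piInf A (r - s * constSeq x * s)‖ < ε := by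
      rw [map_sub, piInf_mul, piInf_mul, hs, hr]
      have h5 : (c : SeqAlg A) - e * piInf A (constSeq x) * e =
          (c - b) - (e * iotaInf x * e - b) := by
        rw [iotaInf]
        abel
      rw [h5]
      linarith [norm_sub_le_of_le hcb.le (le_refl ‖e * iotaInf x * e - b‖)]
    have hq : (0 : ℝ) < 1 / 4 := by norm_num
    filter_upwards [h1, eventually_norm_apply_lt h4,
      hev0 (t := r * r' - s) hq (by rw [map_sub, piInf_mul, hr, hr', hs, h2, sub_self]),
      hev0 (t := r' * r - s) hq (by rw [map_sub, piInf_mul, hr, hr', hs, h3, sub_self]),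
      hev0 (t := r - r * s) hq (by rw [map_sub, piInf_mul, hr, hs, (hunit c c.2).2, sub_self]),
      hev0 (t := r - s * r) hq (by rw [map_sub, piInf_mul, hr, hs, (hunit c c.2).1, sub_self]),
      hev0 (t := r' - r' * s) hq
        (by rw [map_sub, piInf_mul, hr', hs, (hunit c' c'.2).2, sub_self]),
      hev0 (t := r' - s * r') hq
        (by rw [map_sub, piInf_mul, hr', hs, (hunit c' c'.2).1, sub_self]),
      hproj _ hq] with n g1 g2 g3 g4 g5 g6 g7 g8 g9
    refine ⟨by linarith, r n + (1 - s n), isUnit_add_one_sub g3 g4 g5 g6 g7 g8 g9, ?_⟩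
    have h5 : r n + (1 - s n) - (s n * x * s n + (1 - s n)) = r n - s n * x * s n := by abel
    rw [h5]
    exact g2.le
  have hz : ∃ᶠ n in atTop, ‖z‖ - ε < ‖s n * z * s n‖ := by
    refine frequently_lt_norm_apply (t := s * constSeq z * s) ?_
    rw [piInf_mul, piInf_mul, hs]
    have := hnorm z (Finset.mem_insert_self _ _)
    rw [iotaInf] at this
    linarith
  obtain ⟨i, hi⟩ := ((Metric.tendsto_nhds.1 hw) ε hε).exists
  rw [Real.dist_eq, sub_zero, abs_norm] at hi
  obtain ⟨t, ht⟩ := piInf_surjective (w i)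
  have hy : ∀ᶠ n in atTop, ‖1 - s n - star (t n) * (k * k) * t n‖ < ε := by
    refine eventually_norm_apply_lt
      (t := constSeq 1 - s - star t * constSeq (k * k) * t) ?_
    rw [map_sub, map_sub, piInf_mul, piInf_mul, piInf_star, hs, ht]
    exact hi
  -- The quotient norm is a limsup, so the lower bound for `z` holds only frequently; the other
  -- finitely many conditions hold eventually, so a common index exists.
  obtain ⟨n, hzn, hFn, hyn, hpn⟩ := (hz.and_eventually
    (((Finset.eventually_all F).2 hF).and (hy.and (hproj ε hε)))).exists
  refine ⟨s n, hss n, hpn.le, fun x hx => (hFn x hx).1, fun x hx => (hFn x hx).2, hzn.le,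
    k * t n, by rw [← mul_assoc, hdk], ?_⟩
  have h1 : star (k * t n) * (k * t n) - (1 - s n) =
      -(1 - s n - star (t n) * (k * k) * t n) := by
    rw [star_mul, hk.star_eq]
    noncomm_ring
  rw [h1, norm_neg]
  exact hyn.le

end SequenceAlgebra

/-! ### Case (b): completely positive approximations -/

section CompletelyPositive

variable {A : Type u} [CStarAlgebra A] [PartialOrder A] [StarOrderedRing A]

/-- For positive `p` with `‖p‖ ≤ ‖x‖`, positivity gives `γ p ≤ ‖x‖ γ 1`, so `√(γ p) s` is small as
soon as `s (γ 1) s` is. The factor `4` comes from writing `x` as a combination of four positive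
elements. -/
theorem norm_map_mul_le_of_norm_conjugate_le (γ : A →CP A) (hγ : ∀ x, ‖γ x‖ ≤ ‖x‖) {s : A}
    (hs : IsSelfAdjoint s) {η : ℝ} (hη : 0 ≤ η) (h : ‖s * γ 1 * s‖ ≤ η ^ 2) (x : A) :
    ‖γ x * s‖ ≤ 4 * ‖x‖ * η ∧ ‖s * γ x‖ ≤ 4 * ‖x‖ * η := by
  have hpos : ∀ p : A, 0 ≤ p → ‖p‖ ≤ ‖x‖ → ‖γ p * s‖ ≤ ‖x‖ * η := by
    intro p hp hpx
    have hγp : 0 ≤ γ p := map_nonneg γ hp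
    set q := CFC.sqrt (γ p) with hq
    have hqs : star q = q := (IsSelfAdjoint.of_nonneg (CFC.sqrt_nonneg (γ p))).star_eq
    have hqq : q * q = γ p := CFC.sqrt_mul_sqrt_self (γ p)
    have h1 : ‖q‖ * ‖q‖ ≤ ‖x‖ := by
      rw [← CStarRing.norm_star_mul_self, hqs, hqq]
      exact (hγ p).trans hpx
    have h2 : ‖q * s‖ * ‖q * s‖ ≤ ‖x‖ * η ^ 2 := by
      have h3 : star (q * s) * (q * s) = s * γ p * s := by
        rw [star_mul, hqs, hs.star_eq, ← hqq]
        noncomm_ring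
      have h4 : γ p ≤ (‖x‖ : ℂ) • γ 1 := by
        rw [← map_smul]
        have h5 : p ≤ (‖x‖ : ℂ) • (1 : A) := by
          have := (CStarAlgebra.norm_le_iff_le_algebraMap p (norm_nonneg x)).1 hpx
          rwa [Algebra.algebraMap_eq_smul_one, ← Complex.coe_smul] at this
        exact OrderHomClass.mono γ h5
      have h6 : s * γ p * s ≤ s * ((‖x‖ : ℂ) • γ 1) * s := by
        have := star_left_conjugate_le_conjugate h4 s
        rwa [hs.star_eq] at this
      have h7 : 0 ≤ s * γ p * s := by
        rw [← h3]
        exact star_mul_self_nonneg _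
      rw [← CStarRing.norm_star_mul_self, h3]
      refine (CStarAlgebra.norm_le_norm_of_nonneg_of_le h7 h6).trans ?_
      rw [mul_smul_comm, smul_mul_assoc, norm_smul, Complex.norm_real, norm_norm]
      gcongr
    have h3 : ‖γ p * s‖ ≤ ‖q‖ * ‖q * s‖ := by
      rw [← hqq, mul_assoc]
      exact norm_mul_le _ _
    refine h3.trans ?_
    refine (sq_le_sq₀ (by positivity) (by positivity)).1 ?_
    calc (‖q‖ * ‖q * s‖) ^ 2 = (‖q‖ * ‖q‖) * (‖q * s‖ * ‖q * s‖) := by ring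
      _ ≤ ‖x‖ * (‖x‖ * η ^ 2) := by gcongr
      _ = (‖x‖ * η) ^ 2 := by ring
  have hpos' : ∀ p : A, 0 ≤ p → ‖p‖ ≤ ‖x‖ → ‖s * γ p‖ ≤ ‖x‖ * η := by
    intro p hp hpx
    have h1 : star (γ p * s) = s * γ p := by
      rw [star_mul, hs.star_eq, (IsSelfAdjoint.of_nonneg (map_nonneg γ hp)).star_eq]
    rw [← h1, norm_star]
    exact hpos p hp hpx
  obtain ⟨y, hy0, hyn, hy⟩ := CStarAlgebra.exists_sum_four_nonneg x
  constructor
  · conv_lhs => rw [hy]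
    rw [map_sum, Finset.sum_mul]
    refine (norm_sum_le _ _).trans ?_
    refine (Finset.sum_le_card_nsmul _ _ (‖x‖ * η) fun i _ => ?_).trans_eq ?_
    · rw [map_smul, smul_mul_assoc, norm_smul, norm_pow, Complex.norm_I, one_pow, one_mul]
      exact hpos _ (hy0 i) (hyn i)
    · simp [mul_assoc]
  · conv_lhs => rw [hy]
    rw [map_sum, Finset.mul_sum]
    refine (norm_sum_le _ _).trans ?_
    refine (Finset.sum_le_card_nsmul _ _ (‖x‖ * η) fun i _ => ?_).trans_eq ?_
    · rw [map_smul, mul_smul_comm, norm_smul, norm_pow, Complex.norm_I, one_pow, one_mul]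
      exact hpos' _ (hy0 i) (hyn i)
    · simp [mul_assoc]

theorem AsymptoticallyTraciallyIn.approxCornerApproximable
    (hA : AsymptoticallyTraciallyIn.{u, v}
      (fun B [NonUnitalCStarAlgebra B] => UnitalStableRankOne B) A) :
    ApproxCornerApproximable A := by
  classical
  intro F ε hε z d k hk hk0 hdk
  have hkk : 0 ≤ k * k := hk.mul_self_nonneg
  have hkk0 : k * k ≠ 0 := by
    intro h
    rw [← hk.star_eq] at h
    nth_rw 2 [hk.star_eq] at h
    exact hk0 (CStarRing.star_mul_self_eq_zero_iff k |>.1 h)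
  set M : ℝ := 1 + (∑ x ∈ F, ‖x‖ + ‖z‖) with hM
  have hsum : 0 ≤ ∑ x ∈ F, ‖x‖ := Finset.sum_nonneg fun x _ => norm_nonneg x
  have hM1 : 1 ≤ M := by rw [hM]; linarith [norm_nonneg z]
  have hone : ‖(1 : A)‖ ≤ 1 := norm_le_one_of_projection (.one A) (one_mul 1)
  have hFM : ∀ x ∈ insert 1 (insert z F), ‖x‖ ≤ M := fun x hx => by
    rw [Finset.mem_insert, Finset.mem_insert] at hx
    rcases hx with rfl | rfl | hx
    · exact hone.trans hM1
    · rw [hM]; linarith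
    · have := Finset.single_le_sum (f := fun x : A => ‖x‖) (fun x _ => norm_nonneg x) hx
      rw [hM]
      linarith [norm_nonneg z]
  have hM0 : 0 < M := by linarith
  set η : ℝ := min 1 ε / (20 * M) with hη
  have hη0 : 0 < η := by positivity
  have hηM : M * η * 20 = min 1 ε := by rw [hη]; field_simp
  have hM1' : M * η * 20 ≤ 1 := hηM.trans_le (min_le_left _ _)
  have hMε : M * η * 20 ≤ ε := hηM.trans_le (min_le_right _ _)
  have hηM' : η ≤ M * η := le_mul_of_one_le_left hη0.le hM1
  -- With `s = β n (α 1)`, the bound on `s (γ n 1) s` is `δ + 2 * δ`, which must equal `η ^ 2`.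
  set δ : ℝ := η ^ 2 / 3 with hδ
  have hδ0 : 0 < δ := by positivity
  have hδη : δ * 3 ≤ η := by rw [hδ]; nlinarith
  obtain ⟨B, _, _, _, α, β, γ, hB, hα, hβ, hγ, happ, hαm, hαn, hβm, hβn, hcuntz⟩ :=
    hA (insert 1 (insert z F)) δ hδ0 (k * k) hkk hkk0
  obtain ⟨u, hu, hdense⟩ := hB
  have hmul : ∀ (p q : B) (r : ℝ), 0 < r →
      ∀ᶠ n in atTop, ‖β n (p * q) - β n p * β n q‖ < r := by
    intro p q r hr
    filter_upwards [(Metric.tendsto_nhds.1 (hβm p q)) r hr] with n hn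
    rwa [Real.dist_eq, sub_zero, abs_norm] at hn
  have h1mem : (1 : A) ∈ insert 1 (insert z F) := Finset.mem_insert_self _ _
  have hbasic : ∀ x ∈ insert 1 (insert z F), ∀ᶠ n in atTop,
      ‖β n (α 1) * β n (α x) - β n (α x)‖ ≤ 2 * δ ∧
      ‖β n (α x) * β n (α 1) - β n (α x)‖ ≤ 2 * δ := by
    intro x hx
    filter_upwards [hmul (α 1) (α x) δ hδ0, hmul (α x) (α 1) δ hδ0] with n h1 h2
    have h3 : ‖β n (α (1 * x) - α 1 * α x)‖ ≤ δ := (hβ n _).trans (hαm 1 h1mem x hx).le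
    have h4 : ‖β n (α (x * 1) - α x * α 1)‖ ≤ δ := (hβ n _).trans (hαm x hx 1 h1mem).le
    rw [map_sub, one_mul] at h3
    rw [map_sub, mul_one] at h4
    constructor
    · have : β n (α 1) * β n (α x) - β n (α x) =
          -((β n (α x) - β n (α 1 * α x)) + (β n (α 1 * α x) - β n (α 1) * β n (α x))) := by abel
      rw [this, norm_neg]
      linarith [norm_add_le_of_le h3 h1.le]
    · have : β n (α x) * β n (α 1) - β n (α x) =
          -((β n (α x) - β n (α x * α 1)) + (β n (α x * α 1) - β n (α x) * β n (α 1))) := by abel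
      rw [this, norm_neg]
      linarith [norm_add_le_of_le h4 h2.le]
  have hs : ∀ n, IsSelfAdjoint (β n (α 1)) := fun n =>
    .of_nonneg (map_nonneg (β n) (map_nonneg α zero_le_one))
  have hs1 : ∀ n, ‖β n (α 1)‖ ≤ 1 := fun n => ((hβ n _).trans (hα 1)).trans hone
  -- Multiplying `x ≈ γ n x + β n (α x)` by `s = β n (α 1)` on either side kills the `γ` part, so
  -- both `s x` and `x s` are near `β n (α x)`.
  have hcomp : ∀ x ∈ insert 1 (insert z F), ∀ᶠ n in atTop,
      ‖β n (α 1) * x - x * β n (α 1)‖ ≤ ε ∧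
      ‖β n (α 1) * x * β n (α 1) - β n (α x)‖ ≤ 9 * (M * η) := by
    intro x hx
    filter_upwards [hbasic x hx, hbasic 1 h1mem] with n h1 h2
    set s := β n (α 1) with hsdef
    have hsγ : ‖s * γ n 1 * s‖ ≤ η ^ 2 := by
      have h3 : s * γ n 1 * s =
          -(s * (1 - (γ n 1 + s)) * s) - (s * s - s) * s := by noncomm_ring
      rw [h3]
      have h4 : ‖-(s * (1 - (γ n 1 + s)) * s)‖ ≤ 1 * δ * 1 := by
        rw [norm_neg]
        exact norm_mul_le_of_norm_le (norm_mul_le_of_norm_le (hs1 n) (happ 1 h1mem n).le) (hs1 n)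
      have h5 := norm_sub_le_of_le h4 (norm_mul_le_of_norm_le h2.1 (hs1 n))
      have h6 : δ * 3 = η ^ 2 := by rw [hδ]; ring
      linarith
    obtain ⟨h3, h4⟩ := norm_map_mul_le_of_norm_conjugate_le (γ n) (hγ n) (hs n) hη0.le hsγ x
    have hxM : 4 * ‖x‖ * η ≤ 4 * (M * η) := by
      rw [mul_assoc]
      gcongr
      exact hFM x hx
    have hl : ‖s * x - β n (α x)‖ ≤ 5 * (M * η) := by
      have h5 : s * x - β n (α x) =
          s * (x - (γ n x + β n (α x))) + s * γ n x + (s * β n (α x) - β n (α x)) := by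
        noncomm_ring
      rw [h5]
      linarith [norm_add_le_of_le (norm_add_le_of_le
        (norm_mul_le_of_norm_le (hs1 n) (happ x hx n).le) h4) h1.1]
    have hr : ‖x * s - β n (α x)‖ ≤ 5 * (M * η) := by
      have h5 : x * s - β n (α x) =
          (x - (γ n x + β n (α x))) * s + γ n x * s + (β n (α x) * s - β n (α x)) := by
        noncomm_ring
      rw [h5]
      linarith [norm_add_le_of_le (norm_add_le_of_le
        (norm_mul_le_of_norm_le (happ x hx n).le (hs1 n)) h3) h1.2]
    constructor
    · have h5 : s * x - x * s = (s * x - β n (α x)) - (x * s - β n (α x)) := by abel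
      rw [h5]
      linarith [norm_sub_le_of_le hl hr]
    · have h5 : s * x * s - β n (α x) =
          (s * x - β n (α x)) * s + (β n (α x) * s - β n (α x)) := by noncomm_ring
      rw [h5]
      linarith [norm_add_le_of_le (norm_mul_le_of_norm_le hl (hs1 n)) h1.2]
  have hunit : ∀ x ∈ F, ∀ᶠ n in atTop,
      ∃ v : A, IsUnit v ∧ ‖v - (β n (α 1) * x * β n (α 1) + (1 - β n (α 1)))‖ ≤ ε := by
    intro x hx
    have hx' : x ∈ insert 1 (insert z F) := by simp [hx]
    -- `α 1` need not be near the unit `u` of `B`. The shift by `u - α 1` compensates: `β n b + (1 -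
    -- β n u)` is then near `β n (α x) + (1 - β n (α 1))`.
    obtain ⟨b, hbd, b', hbb', hb'b⟩ := Metric.dense_iff.1 hdense (α x + u - α 1) δ hδ0
    rw [Metric.mem_ball, dist_eq_norm] at hbd
    have hq : (0 : ℝ) < 1 / 4 := by norm_num
    filter_upwards [hcomp x hx', hmul b b' _ hq, hmul b' b _ hq, hmul b u _ hq, hmul u b _ hq,
      hmul b' u _ hq, hmul u b' _ hq, hmul u u _ hq] with n h1 g1 g2 g3 g4 g5 g6 g7
    rw [hbb', norm_sub_rev] at g1
    rw [hb'b, norm_sub_rev] at g2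
    rw [(hu b).2] at g3
    rw [(hu b).1] at g4
    rw [(hu b').2] at g5
    rw [(hu b').1] at g6
    rw [(hu u).1, norm_sub_rev] at g7
    refine ⟨β n b + (1 - β n u), isUnit_add_one_sub g1 g2 g3 g4 g5 g6 g7, ?_⟩
    have h2 : ‖β n (b - (α x + u - α 1))‖ ≤ δ := (hβ n _).trans hbd.le
    have h3 : β n b + (1 - β n u) - (β n (α 1) * x * β n (α 1) + (1 - β n (α 1))) =
        β n (b - (α x + u - α 1)) - (β n (α 1) * x * β n (α 1) - β n (α x)) := by
      rw [map_sub, map_sub, map_add]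
      abel
    rw [h3]
    linarith [norm_sub_le_of_le h2 h1.2]
  have hz' : z ∈ insert 1 (insert z F) := by simp
  have hz : ∀ᶠ n in atTop, ‖α z‖ - η < ‖β n (α z)‖ :=
    (hβn (α z)).eventually_const_lt (by linarith)
  have hF : ∀ x ∈ F, ∀ᶠ n in atTop, ‖β n (α 1) * x - x * β n (α 1)‖ ≤ ε := by
    intro x hx
    filter_upwards [hcomp x (by simp [hx])] with n hn
    exact hn.1
  obtain ⟨n, h1, h2, h3, h4, h5⟩ := (((Finset.eventually_all F).2 hF).and
    (((Finset.eventually_all F).2 hunit).and (hz.and ((hcomp z hz').and (hbasic 1 h1mem))))).exists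
  obtain ⟨w, hw⟩ := hcuntz n
  obtain ⟨i, hi⟩ := ((Metric.tendsto_nhds.1 hw) δ hδ0).exists
  rw [Real.dist_eq, sub_zero, abs_norm] at hi
  refine ⟨β n (α 1), hs n, by linarith [h5.1], h1, h2, ?_, k * w i,
    by rw [← mul_assoc, hdk], ?_⟩
  · have h6 := abs_lt.1 (hαn z hz')
    have h7 := norm_sub_norm_le (β n (α z)) (β n (α 1) * z * β n (α 1))
    rw [norm_sub_rev] at h7
    linarith [h4.2]
  · have h6 : star (k * w i) * (k * w i) - (1 - β n (α 1)) =
        -(1 - (γ n 1 + β n (α 1))) - (γ n 1 - star (w i) * (k * k) * w i) := by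
      rw [star_mul, hk.star_eq]
      noncomm_ring
    have h7 : ‖-(1 - (γ n 1 + β n (α 1)))‖ ≤ δ := by
      rw [norm_neg]
      exact (happ 1 h1mem n).le
    rw [h6]
    linarith [norm_sub_le_of_le h7 hi.le]

end CompletelyPositive

end TracialApprox

theorem mainTheorem12 (A : Type u) [CStarAlgebra A] [PartialOrder A] [StarOrderedRing A]
    (hA : TracialApprox.IsSimpleCStar A) :
    (TracialApprox.ApproximatedByStableRankOne A → TracialApprox.UnitalStableRankOne A) ∧
    (TracialApprox.AsymptoticallyTraciallyIn.{u, v}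
        (fun B [NonUnitalCStarAlgebra B] => TracialApprox.UnitalStableRankOne B) A →
      TracialApprox.UnitalStableRankOne A) := by
  have key : TracialApprox.ApproxCornerApproximable A → TracialApprox.UnitalStableRankOne A :=
    fun h => (TracialApprox.unitalStableRankOne_iff A).2
      (TracialApprox.dense_isUnit_of_cornerApproximable hA h.cornerApproximable)
  exact ⟨fun h => key h.approxCornerApproximable, fun h => key h.approxCornerApproximable⟩
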